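/- Consider the 3-user MISO broadcast channel: a transmitter with three antennas sends $X(t)\in\mathbb C^3$, and receiver $i\in\{1,2,3\}$ observes $Y_i(t)=H_i(t)X(t)+Z_i(t)$. The channel row vectors $H_i(t)\in\mathbb C^{1\times 3}$ are independent over $i$ and $t$, the law of $H_i(t)$ does not depend on $t$, and it is generic: it gives probability $0$ to every proper linear subspace of $\mathbb C^3$ (as every absolutely continuous law does). The noises $Z_i(t)$ are independent of each other and of the channels, circularly symmetric complex Gaussian with mean $0$ and a positive variance that depends only on $i$. Every receiver knows all channels. The channel state information at the transmitter (CSIT) alternates with period nine slots. In slots $1,\dots,7$ of each period the CSIT is hybrid: $H_1(t)$ is known at time $t$, while $H_2(t)$ and $H_3(t)$ are known only from time $t+1$ on. In slots $8,9$ the vectors $H_2(t),H_3(t)$ are known at time $t$ and $H_1(t)$ is never known. The signal $X(t)$ may depend only on the messages (data symbols) and on the channel vectors known to the transmitter at time $t$. For power $P>0$ let $\mathcal C(P)$ be the set of rate tuples $(R_1,R_2,R_3)$ for which there are codes of all block lengths $n$, with independent uniformly distributed messages from sets of sizes $M_{n,i}$ for receivers $i=1,2,3$, such that $E\|X(t)\|^2\le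 P$ for every $t$, $\frac1n\log M_{n,i}\to R_i$, and the error probability at every receiver tends to $0$ as $n\to\infty$. The degrees-of-freedom (DoF) region is the set of $(d_1,d_2,d_3)$ with $d_i\ge 0$ for which there are rate tuples $(R_1(P),R_2(P),R_3(P))\in\mathcal C(P)$, $P>0$, with $d_i=\lim_{P\to\infty}R_i(P)/\log P$ for $i=1,2,3$. Then the following hold. 1. There is a linear scheme over one period of nine slots that sends $9$, $4$ and $4$ independent complex data symbols to receivers $1$, $2$ and $3$: measurable and bounded precoding matrices $V_k(t)$, where $V_k(t)$ depends only on the channel vectors known to the transmitter at time $t$, such that with $X(t)=\sum_{k=1}^3V_k(t)s_k$, $s_1\in\mathbb C^9$, $s_2,s_3\in\mathbb C^4$, almost surely every receiver $j$ recovers $s_j$ by a linear map (depending on the channels) from its noise-free outputs $(H_j(t)X(t))_{t=1}^9$, for all $s_1,s_2,s_3$. 2. The tuple $(1,\frac49,\frac49)$ belongs to the DoF region under this alternating CSIT. 3. The tuple $(1,\frac49,\frac49)$ is a corner point (extreme point) of the outer bound for hybrid CSIT with private messages, that is, of the polytope of all $(d_1,d_2,d_3)\in\mathbb R^3$ with $0\le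 d_1,d_2,d_3\le 1$, $\frac{d_1}2+d_2\le1$, $\frac{d_1}2+d_3\le1$, $\frac{d_1}3+\frac{d_2}2+d_3\le1$ and $\frac{d_1}3+d_2+\frac{d_3}2\le1$. -/

import Mathlib

open MeasureTheory ProbabilityTheory Filter Topology
open scoped NNReal ENNReal Matrix

noncomputable section

namespace MISOBC

/-! Three-user MISO broadcast channel: a transmitter with three antennas and three
single-antenna receivers. Times, receivers and antennas are numbered from `0`. -/

/-- The channel matrices over `n` channel uses: `H t i` is the row vector `H_i(t)` of the channel
from the three transmit antennas to receiver `i` at time `t`. -/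
abbrev ChannelSeq (n : ℕ) : Type := Fin n → Fin 3 → Fin 3 → ℂ

/-- The additive noises over `n` channel uses: `Z t i` is the noise at receiver `i`, time `t`. -/
abbrev NoiseSeq (n : ℕ) : Type := Fin n → Fin 3 → ℂ

/-- The law of the channels: all `H_i(t)` are independent, and `H_i(t)` has law `ν i` at
every time `t`. -/
def channelLaw (ν : Fin 3 → Measure (Fin 3 → ℂ)) (n : ℕ) : Measure (ChannelSeq n) :=
  Measure.pi fun _ => Measure.pi fun i => ν i

/-- A law of a channel vector is generic if it charges no proper linear subspace of `ℂ³`.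
Every law that is absolutely continuous with respect to Lebesgue measure is generic. -/
def IsGeneric (μ : Measure (Fin 3 → ℂ)) : Prop :=
  ∀ U : Submodule ℂ (Fin 3 → ℂ), U ≠ ⊤ → μ (U : Set (Fin 3 → ℂ)) = 0

/-- The circularly symmetric complex Gaussian law with mean `0` and variance `v`: the real and
imaginary parts are independent real Gaussians of variance `v / 2`. -/
def complexGaussian (v : ℝ≥0) : Measure ℂ :=
  Measure.map (fun p : ℝ × ℝ => (⟨p.1, p.2⟩ : ℂ))
    ((gaussianReal 0 (v / 2)).prod (gaussianReal 0 (v / 2)))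

/-- The law of the noise: independent over time and receivers, with variance `N i` at
receiver `i`. -/
def noiseLaw (N : Fin 3 → ℝ≥0) (n : ℕ) : Measure (NoiseSeq n) :=
  Measure.pi fun _ => Measure.pi fun i => complexGaussian (N i)

/-! ### Channel state information at the transmitter -/

/-- What the transmitter learns about the channel to one receiver in one slot: nothing; the
channel with unit delay; or the channel instantaneously. -/
inductive CSIT : Type
  | none
  | delayed
  | perfect

/-- The hybrid state: instantaneous CSIT for the first receiver, delayed for the other two. -/
def hybridState : Fin 3 → CSIT := ![CSIT.perfect, CSIT.delayed, CSIT.delayed]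

/-- The NPP state: no CSIT for the first receiver, perfect CSIT for the other two. -/
def nppState : Fin 3 → CSIT := ![CSIT.none, CSIT.perfect, CSIT.perfect]

/-- The alternating CSIT pattern of period nine: seven slots in the hybrid state, then two slots
in the NPP state. `alternatingCSIT t i` is the kind of CSIT about `H_i(t)`. -/
def alternatingCSIT (t : ℕ) : Fin 3 → CSIT :=
  if t % 9 < 7 then hybridState else nppState

/-- Under the pattern `csit`, the transmitter knows `H_i(s)` when it forms its signal at
time `t`. -/
def Known (csit : ℕ → Fin 3 → CSIT) (t s : ℕ) (i : Fin 3) : Prop :=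
  (csit s i = CSIT.perfect ∧ s ≤ t) ∨ (csit s i = CSIT.delayed ∧ s < t)

/-- A quantity `f H t`, one for each time `t`, is causal if at time `t` it depends only on those
channel vectors that the transmitter knows at time `t`. -/
def IsCausal (csit : ℕ → Fin 3 → CSIT) {n : ℕ} {α : Type} (f : ChannelSeq n → Fin n → α) : Prop :=
  ∀ (t : Fin n) (H H' : ChannelSeq n),
    (∀ (s : Fin n) (i : Fin 3), Known csit t s i → H s i = H' s i) → f H t = f H' t

/-! ### Linear schemes -/

/-- A linear scheme over `T` slots that sends `b k` complex data symbols to each receiver `k`. At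
time `t` the transmitter sends `∑ k, V k H t *ᵥ s k`, where `s k` is the vector of data symbols for
receiver `k`. The precoders are measurable and causal, and they are bounded, so that a power
constraint can be met by scaling. -/
structure LinearScheme (csit : ℕ → Fin 3 → CSIT) (T : ℕ) (b : Fin 3 → ℕ) where
  V : (k : Fin 3) → ChannelSeq T → Fin T → Matrix (Fin 3) (Fin (b k)) ℂ
  measurable_V : ∀ (k : Fin 3) (t : Fin T) (a : Fin 3) (l : Fin (b k)),
    Measurable fun H => V k H t a l
  causal_V : ∀ k, IsCausal csit (V k)
  bounded_V : ∃ C : ℝ, ∀ k H t a l, ‖V k H t a l‖ ≤ C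

/-- The signal sent by a linear scheme for data symbols `s`. -/
def LinearScheme.signal {csit : ℕ → Fin 3 → CSIT} {T : ℕ} {b : Fin 3 → ℕ}
    (S : LinearScheme csit T b) (s : (k : Fin 3) → Fin (b k) → ℂ) (H : ChannelSeq T)
    (t : Fin T) : Fin 3 → ℂ :=
  ∑ k, S.V k H t *ᵥ s k

/-- Almost surely, every receiver `j`, which knows all the channels, recovers its data symbols by a
linear map from its noise-free outputs `H_j(t) X(t)`, whatever all the data symbols are. -/
def LinearScheme.Decodable {csit : ℕ → Fin 3 → CSIT} {T : ℕ} {b : Fin 3 → ℕ}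
    (S : LinearScheme csit T b) (ν : Fin 3 → Measure (Fin 3 → ℂ)) : Prop :=
  ∀ᵐ H ∂(channelLaw ν T), ∀ j : Fin 3, ∃ D : Matrix (Fin (b j)) (Fin T) ℂ,
    ∀ s : (k : Fin 3) → Fin (b k) → ℂ, D *ᵥ (fun t => H t j ⬝ᵥ S.signal s H t) = s j

/-! ### Codes, capacity region and DoF region -/

/-- A block code of length `n` with `M i` messages for each receiver `i`. The encoder is causal with
respect to the CSIT pattern; each decoder sees all the channels and its own outputs. -/
structure Code (csit : ℕ → Fin 3 → CSIT) (n : ℕ) (M : Fin 3 → ℕ) where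
  enc : ((i : Fin 3) → Fin (M i)) → ChannelSeq n → Fin n → Fin 3 → ℂ
  measurable_enc : ∀ m, Measurable (enc m)
  causal_enc : ∀ m, IsCausal csit (enc m)
  dec : (i : Fin 3) → ChannelSeq n → (Fin n → ℂ) → Fin (M i)
  measurable_dec : ∀ i, Measurable (Function.uncurry (dec i))

/-- The power constraint `E ‖X(t)‖² ≤ P` at every time `t`, with expectation over independent,
uniformly distributed messages and over the channels. -/
def Code.PowerConstraint {csit : ℕ → Fin 3 → CSIT} {n : ℕ} {M : Fin 3 → ℕ} (c : Code csit n M)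
    (ν : Fin 3 → Measure (Fin 3 → ℂ)) (P : ℝ) : Prop :=
  ∀ t : Fin n,
    (∑ m : (i : Fin 3) → Fin (M i), ∫⁻ H, ∑ a, ‖c.enc m H t a‖ₑ ^ 2 ∂(channelLaw ν n)) /
      (∏ i, (M i : ℝ≥0∞)) ≤ ENNReal.ofReal P

/-- The outputs `Y_i(t) = H_i(t) X(t) + Z_i(t)` at receiver `i` when the messages are `m`. -/
def Code.output {csit : ℕ → Fin 3 → CSIT} {n : ℕ} {M : Fin 3 → ℕ} (c : Code csit n M)
    (m : (i : Fin 3) → Fin (M i)) (H : ChannelSeq n) (Z : NoiseSeq n) (i : Fin 3) : Fin n → ℂ :=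
  fun t => H t i ⬝ᵥ c.enc m H t + Z t i

/-- The probability that receiver `i` decodes its message wrongly, for independent, uniformly
distributed messages and independent channels and noise. -/
def Code.errorProb {csit : ℕ → Fin 3 → CSIT} {n : ℕ} {M : Fin 3 → ℕ} (c : Code csit n M)
    (ν : Fin 3 → Measure (Fin 3 → ℂ)) (N : Fin 3 → ℝ≥0) (i : Fin 3) : ℝ≥0∞ :=
  (∑ m : (j : Fin 3) → Fin (M j), ((channelLaw ν n).prod (noiseLaw N n))
      {ω | c.dec i ω.1 (c.output m ω.1 ω.2 i) ≠ m i}) /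
    (∏ j, (M j : ℝ≥0∞))

/-- The capacity region at power `P`: the rate tuples `R` for which there are codes of all
block lengths `n`, under the power constraint `P`, with `log (M n i) / n → R i` and with error
probability tending to `0` at every receiver. -/
def capacityRegion (ν : Fin 3 → Measure (Fin 3 → ℂ)) (N : Fin 3 → ℝ≥0)
    (csit : ℕ → Fin 3 → CSIT) (P : ℝ) : Set (Fin 3 → ℝ) :=
  {R | ∃ (M : ℕ → Fin 3 → ℕ) (c : (n : ℕ) → Code csit n (M n)),
    (∀ n, (c n).PowerConstraint ν P) ∧
    (∀ i, Tendsto (fun n : ℕ => Real.log (M n i) / n) atTop (𝓝 (R i))) ∧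
    (∀ i, Tendsto (fun n : ℕ => (c n).errorProb ν N i) atTop (𝓝 0))}

/-- The degrees-of-freedom region: the pre-log factors of the capacity region as `P → ∞`. -/
def dofRegion (ν : Fin 3 → Measure (Fin 3 → ℂ)) (N : Fin 3 → ℝ≥0)
    (csit : ℕ → Fin 3 → CSIT) : Set (Fin 3 → ℝ) :=
  {d | (∀ i, 0 ≤ d i) ∧ ∃ R : ℝ → Fin 3 → ℝ,
    (∀ P : ℝ, 0 < P → R P ∈ capacityRegion ν N csit P) ∧
    ∀ i, Tendsto (fun P : ℝ => R P i / Real.log P) atTop (𝓝 (d i))}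

/-- The outer bound for private messages on the DoF region of the three-user MISO broadcast channel
under hybrid CSIT. -/
def hybridOuterBound : Set (Fin 3 → ℝ) :=
  {d | (∀ i, 0 ≤ d i ∧ d i ≤ 1) ∧
    d 0 / 2 + d 1 ≤ 1 ∧
    d 0 / 2 + d 2 ≤ 1 ∧
    d 0 / 3 + d 1 / 2 + d 2 ≤ 1 ∧
    d 0 / 3 + d 1 + d 2 / 2 ≤ 1}

end MISOBC

end

noncomputable section

namespace MISOBC

/-! ### The corner point of the outer bound -/

/-! Receivers are numbered 0, 1, 2 and slots 0 to 8. In slots 0 and 1 receiver 0 is sent two triples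
A and B of symbols, superposed with two fresh symbols per slot for each of receivers 1 and 2, beamed
into the null space of receiver 0. Slots 2 and 3 repeat in that null space what receiver 2 overheard
of receiver 1's symbols plus what receiver 1 overheard of receiver 2's, alongside one new symbol c
or d for receiver 0. Overheard interference is thereby aligned. Receiver i ∈ {1, 2} can resolve it
once it knows f_i (a combination of c and A, `fRow`) and g_i (of d and B, `gRow`). These four
quantities are also what receiver 0 lacks to solve for A and B, so they are useful to two receivers
at once.

Slot 4 sends f_1 + f_2 to everybody and g_1 + g_2 in the null space of receiver 0. Slots 5 and 6
resend the part of slot 4 that receiver 1, respectively receiver 2, saw as interference, and add in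
the null space one more equation on the aligned symbols. With perfect knowledge of channels 1 and 2,
slots 7 and 8 deliver f_i and g_i to receiver i free of interference, and slot 7 also carries a
ninth symbol nulled at both. Decoding is the triviality of a kernel (`decode_first`,
`decode_second`, `decode_third`), valid when finitely many expressions do not vanish. Each is linear
in one channel vector with a coefficient not involving it, so genericity and Fubini give this almost
surely (`ae_dotProduct_ne_zero`).

Any decodable linear scheme over a period T yields the tuple b/T (`mem_dofRegion_of_decodable`).
Symbols are put on an L × L grid of spacing log P, with L of order √P / log P. A block is decoded
wrongly only if the noise exceeds a channel-dependent multiple of the spacing, which has vanishing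
probability uniformly in L. An outer Gilbert–Varshamov code over the blocks corrects the remaining
small fraction of bad blocks at vanishing relative rate loss, and a Chernoff bound drives the error
probability to 0 at fixed P. -/

theorem corner_mem_extremePoints :
    (![1, 4 / 9, 4 / 9] : Fin 3 → ℝ) ∈ Set.extremePoints ℝ hybridOuterBound := by
  refine ⟨?_, ?_⟩
  · refine ⟨fun i => ?_, ?_, ?_, ?_, ?_⟩
    · fin_cases i <;> norm_num
    · show (1 : ℝ) / 2 + 4 / 9 ≤ 1; norm_num
    · show (1 : ℝ) / 2 + 4 / 9 ≤ 1; norm_num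
    · show (1 : ℝ) / 3 + 4 / 9 / 2 + 4 / 9 ≤ 1; norm_num
    · show (1 : ℝ) / 3 + 4 / 9 + 4 / 9 / 2 ≤ 1; norm_num
  · rintro x ⟨hx, -, -, hx1, hx2⟩ y ⟨hy, -, -, hy1, hy2⟩ ⟨a, b, ha, hb, hab, h⟩
    have h0 : a * x 0 + b * y 0 = 1 := by simpa using congrFun h 0
    have h1 : a * x 1 + b * y 1 = 4 / 9 := by simpa using congrFun h 1
    have h2 : a * x 2 + b * y 2 = 4 / 9 := by simpa using congrFun h 2
    -- Three constraints are tight at the corner: the bound on the first coordinate and the two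
    -- bounds with coefficients 1/3, 1/2, 1. They are linearly independent, and both endpoints of a
    -- segment through the corner must meet them with equality.
    have tight : ∀ p q : ℝ, p ≤ 1 → q ≤ 1 → a * p + b * q = 1 → p = 1 := by
      intro p q hp hq hpq
      have : a * (1 - p) ≤ 0 := by nlinarith
      linarith [nonpos_of_mul_nonpos_right this ha]
    have e0 := tight _ _ (hx 0).2 (hy 0).2 h0
    have e1 := tight _ _ hx1 hy1 (by linarith)
    have e2 := tight _ _ hx2 hy2 (by linarith)
    ext i
    fin_cases i <;> simp <;> linarith

/-! ### Linear schemes from causal precoders that need not be bounded -/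

/-- A linear functional of the unknowns that vanishes whenever the observations vanish is a linear
function of the observations. -/
theorem exists_matrix_of_ker_le {E : Type*} [AddCommGroup E] [Module ℂ E] {m n : Type*} [Fintype m]
    [Fintype n] [DecidableEq n]
    (Y : E →ₗ[ℂ] (n → ℂ)) (p : E →ₗ[ℂ] (m → ℂ)) (h : ∀ x, Y x = 0 → p x = 0) :
    ∃ D : Matrix m n ℂ, ∀ x, D *ᵥ Y x = p x := by
  obtain ⟨g, hg⟩ := LinearMap.exists_extend
    (((LinearMap.ker Y).liftQ p (fun x hx => h x hx)) ∘ₗ Y.quotKerEquivRange.symm.toLinearMap)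
  refine ⟨LinearMap.toMatrix' g, fun x => ?_⟩
  rw [LinearMap.toMatrix'_mulVec]
  have := LinearMap.congr_fun hg (⟨Y x, x, rfl⟩ : LinearMap.range Y)
  have e : Y.quotKerEquivRange.symm ⟨Y x, x, rfl⟩ = (LinearMap.ker Y).mkQ x := by
    rw [LinearEquiv.symm_apply_eq]; rfl
  rw [LinearMap.comp_apply, LinearMap.comp_apply, LinearEquiv.coe_coe, e] at this
  exact this

/-- Dividing the precoders of slot `t` by one plus the sum of their norms makes them bounded by 1.
The factor is a function of the same precoders, so causality survives; it is nonzero, so the kernel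
condition survives, and that condition is equivalent to linear decodability. -/
theorem exists_decodable_linearScheme {csit : ℕ → Fin 3 → CSIT} {T : ℕ} {b : Fin 3 → ℕ}
    (ν : Fin 3 → Measure (Fin 3 → ℂ))
    (V : (k : Fin 3) → ChannelSeq T → Fin T → Matrix (Fin 3) (Fin (b k)) ℂ)
    (hmeas : ∀ k t a l, Measurable fun H => V k H t a l)
    (hcausal : ∀ k, IsCausal csit (V k))
    (hker : ∀ᵐ H ∂(channelLaw ν T), ∀ (j : Fin 3) (s : (k : Fin 3) → Fin (b k) → ℂ),
      (∀ t, H t j ⬝ᵥ ∑ k, V k H t *ᵥ s k = 0) → s j = 0) :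
    ∃ S : LinearScheme csit T b, S.Decodable ν := by
  set N : ChannelSeq T → Fin T → ℝ := fun H t => 1 + ∑ k, ∑ a, ∑ l, ‖V k H t a l‖ with hN
  have hN1 : ∀ H t, 1 ≤ N H t := fun H t => by
    have : 0 ≤ ∑ k, ∑ a, ∑ l, ‖V k H t a l‖ := by positivity
    simp only [hN]; linarith
  have hNm : ∀ t, Measurable fun H => N H t := fun t => by
    refine measurable_const.add ?_
    refine Finset.measurable_fun_sum _ fun k _ => Finset.measurable_fun_sum _ fun a _ =>
      Finset.measurable_fun_sum _ fun l _ => (hmeas k t a l).norm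
  refine ⟨⟨fun k H t => ((N H t)⁻¹ : ℂ) • V k H t, fun k t a l => ?_, fun k t H H' h => ?_,
    1, fun k H t a l => ?_⟩, ?_⟩
  · exact ((Complex.measurable_ofReal.comp (hNm t)).inv).mul (hmeas k t a l)
  · have hk : ∀ k, V k H t = V k H' t := fun k => hcausal k t H H' h
    simp only [hN, hk]
  · have h0 : 0 < N H t := by linarith [hN1 H t]
    rw [Matrix.smul_apply, norm_smul, norm_inv, Complex.norm_real, Real.norm_of_nonneg h0.le,
      inv_mul_le_one₀ h0]
    have h1 : ‖V k H t a l‖ ≤ ∑ k, ∑ a, ∑ l, ‖V k H t a l‖ := by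
      refine le_trans ?_ (Finset.single_le_sum (f := fun k => ∑ a, ∑ l, ‖V k H t a l‖)
        (fun _ _ => by positivity) (Finset.mem_univ k))
      refine le_trans ?_ (Finset.single_le_sum (f := fun a => ∑ l, ‖V k H t a l‖)
        (fun _ _ => by positivity) (Finset.mem_univ a))
      exact Finset.single_le_sum (f := fun l => ‖V k H t a l‖)
        (fun _ _ => by positivity) (Finset.mem_univ l)
    simp only [hN]; linarith
  · filter_upwards [hker] with H hH j
    let Y : ((k : Fin 3) → Fin (b k) → ℂ) →ₗ[ℂ] (Fin T → ℂ) :=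
      LinearMap.pi fun t => ∑ k, (dotProductBilin ℂ ℂ (H t j)) ∘ₗ
        (Matrix.mulVecLin (((N H t)⁻¹ : ℂ) • V k H t)) ∘ₗ LinearMap.proj k
    have hY : ∀ s, Y s = fun t => H t j ⬝ᵥ ∑ k, (((N H t)⁻¹ : ℂ) • V k H t) *ᵥ s k := by
      intro s; ext t
      simp [Y, LinearMap.pi_apply, dotProduct_sum, Matrix.smul_mulVec, dotProduct_smul]
    obtain ⟨D, hD⟩ := exists_matrix_of_ker_le Y (LinearMap.proj j) (fun s hs => by
      refine hH j s fun t => ?_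
      have := congrFun hs t
      rw [hY] at this
      simp only [Matrix.smul_mulVec, ← Finset.smul_sum, dotProduct_smul, Pi.zero_apply,
        smul_eq_mul, mul_eq_zero, inv_eq_zero, Complex.ofReal_eq_zero] at this
      exact this.resolve_left (by linarith [hN1 H t]))
    exact ⟨D, fun s => by
      have := hD s
      rw [hY] at this
      exact this⟩

/-! ### Almost sure properties of generic channels -/

/-- Fubini in the single coordinate `i`: a measurable set whose sections in that coordinate are all
null is null. -/
theorem ae_pi_of_forall_update {ι : Type*} [Fintype ι] [DecidableEq ι] {X : ι → Type*}
    [∀ i, MeasurableSpace (X i)] (μ : (i : ι) → Measure (X i)) [∀ i, SigmaFinite (μ i)] (i : ι)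
    {p : (∀ i, X i) → Prop} (hp : MeasurableSet {x | p x})
    (h : ∀ x, ∀ᵐ y ∂(μ i), p (Function.update x i y)) : ∀ᵐ x ∂(Measure.pi μ), p x := by
  have hm : Measurable ({x | p x}ᶜ.indicator (1 : (∀ i, X i) → ℝ≥0∞)) :=
    measurable_one.indicator hp.compl
  rw [ae_iff, ← Set.compl_ofPred, ← lintegral_indicator_one hp.compl]
  refine (lintegral_eq_of_lmarginal_eq {i} hm measurable_zero ?_).trans (by simp)
  ext x
  rw [lmarginal_singleton, lmarginal_singleton]
  refine lintegral_congr_ae ?_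
  filter_upwards [h x] with y hy
  simpa using hy

/-- With all other channel vectors frozen, `φ H` is a fixed nonzero vector because `hupd` makes it
independent of `H t i`. Its orthogonal hyperplane is a proper subspace, which a generic law does not
charge. -/
theorem ae_dotProduct_ne_zero {ν : Fin 3 → Measure (Fin 3 → ℂ)} [∀ i, IsProbabilityMeasure (ν i)]
    (hgen : ∀ i, IsGeneric (ν i)) {n : ℕ} (t : Fin n) (i : Fin 3)
    (φ : ChannelSeq n → Fin 3 → ℂ) (hφ : Measurable φ)
    (hupd : ∀ H v, φ (Function.update H t (Function.update (H t) i v)) = φ H)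
    (h : ∀ᵐ H ∂(channelLaw ν n), φ H ≠ 0) :
    ∀ᵐ H ∂(channelLaw ν n), H t i ⬝ᵥ φ H ≠ 0 := by
  suffices h' : ∀ᵐ H ∂(channelLaw ν n), φ H ≠ 0 → H t i ⬝ᵥ φ H ≠ 0 by
    filter_upwards [h, h'] with H h1 h2 using h2 h1
  have hpm : MeasurableSet {H : ChannelSeq n | φ H ≠ 0 → H t i ⬝ᵥ φ H ≠ 0} := by
    have e : {H : ChannelSeq n | φ H ≠ 0 → H t i ⬝ᵥ φ H ≠ 0} =
        {H | φ H = 0} ∪ {H | H t i ⬝ᵥ φ H = 0}ᶜ := by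
      ext H; simp; tauto
    rw [e]
    refine (hφ (measurableSet_singleton 0)).union (MeasurableSet.compl ?_)
    refine (measurableSet_singleton (0 : ℂ)).preimage ?_
    simp only [dotProduct]
    fun_prop
  refine ae_pi_of_forall_update _ t hpm fun H => ?_
  refine ae_pi_of_forall_update _ i ?_ fun r => ?_
  · exact hpm.preimage (measurable_update H)
  · by_cases h0 : φ (Function.update H t r) = 0
    · refine ae_of_all _ fun v hv => absurd ?_ hv
      rw [← hupd _ v] at h0
      simpa using h0
    · have hU := hgen i (LinearMap.ker (dotProductBilin ℂ ℂ (φ (Function.update H t r)))) (by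
        intro htop
        rw [LinearMap.ker_eq_top] at htop
        apply h0
        ext a
        simpa using LinearMap.congr_fun htop (Pi.single a 1))
      rw [ae_iff]
      refine measure_mono_null (fun v hv => ?_) hU
      have hv' := hv
      simp only [Set.mem_ofPred_eq, not_forall, not_not] at hv'
      obtain ⟨-, hv'⟩ := hv'
      have e := hupd (Function.update H t r) v
      simp only [Function.update_self, Function.update_idem] at e hv'
      rw [e, dotProduct_comm] at hv'
      simpa using hv'

/-! ### The scheme over one period -/

/-- The first standard basis vector. -/
def e₀ : Fin 3 → ℂ := ![1, 0, 0]

/-- The second standard basis vector. -/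
def e₁ : Fin 3 → ℂ := ![0, 1, 0]

/-- The functional of the nine symbols for the first receiver that pairs a vector with the first
three of them. -/
def rowA (h : Fin 3 → ℂ) : Fin 9 → ℂ :=
  h 0 • Pi.single 0 1 + h 1 • Pi.single 1 1 + h 2 • Pi.single 2 1

/-- The functional that pairs a vector with symbols `3`, `4`, `5`. -/
def rowB (h : Fin 3 → ℂ) : Fin 9 → ℂ :=
  h 0 • Pi.single 3 1 + h 1 • Pi.single 4 1 + h 2 • Pi.single 5 1

/-- The symbol with index `6`. -/
def rowC : Fin 9 → ℂ := Pi.single 6 1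

/-- The symbol with index `7`. -/
def rowD : Fin 9 → ℂ := Pi.single 7 1

/-- The symbol with index `8`. -/
def rowE : Fin 9 → ℂ := Pi.single 8 1

/-- The vector orthogonal to the channel of the first receiver along which the data symbols
of the other receivers are sent. -/
def beam (h : Fin 3 → Fin 3 → ℂ) : Fin 3 → ℂ := h 0 ⨯₃ e₀

/-- The gain of receiver `i` along `beam`. -/
def gain (h : Fin 3 → Fin 3 → ℂ) (i : Fin 3) : ℂ := h i ⬝ᵥ beam h

/-- The combination of symbols for the first receiver that receiver `i` sees in slot `2`,
after removing what is aligned with slot `0`. -/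
def fRow (H : ChannelSeq 9) (i : Fin 3) : Fin 9 → ℂ :=
  H 2 i 0 • rowC - gain (H 2) i • rowA (H 0 i)

/-- The same as `fRow` for slots `3` and `1`. -/
def gRow (H : ChannelSeq 9) (i : Fin 3) : Fin 9 → ℂ :=
  H 3 i 0 • rowD - gain (H 3) i • rowB (H 1 i)

/-- What receiver `i` sees of the first two symbols of receiver `1` or `2` in slot `0`. -/
def pairRow (h : Fin 3 → Fin 3 → ℂ) (i : Fin 3) : Fin 4 → ℂ :=
  (h i ⬝ᵥ (h 0 ⨯₃ e₀)) • Pi.single 0 1 + (h i ⬝ᵥ (h 0 ⨯₃ e₁)) • Pi.single 1 1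

/-- What receiver `i` sees of the last two symbols of receiver `1` or `2` in slot `1`. -/
def pairRow' (h : Fin 3 → Fin 3 → ℂ) (i : Fin 3) : Fin 4 → ℂ :=
  (h i ⬝ᵥ (h 0 ⨯₃ e₀)) • Pi.single 2 1 + (h i ⬝ᵥ (h 0 ⨯₃ e₁)) • Pi.single 3 1

/-- The precoders for the first receiver. -/
def precoder₀ (H : ChannelSeq 9) : Fin 9 → Matrix (Fin 3) (Fin 9) ℂ
  | 0 => Matrix.of fun a => rowA (Pi.single a 1)
  | 1 => Matrix.of fun a => rowB (Pi.single a 1)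
  -- No nulling is needed here: in slots 2 and 3 receiver 0 sees only this symbol, everything else
  -- being sent along `beam`.
  | 2 => Matrix.vecMulVec e₀ rowC
  | 3 => Matrix.vecMulVec e₀ rowD
  | 4 => Matrix.vecMulVec e₀ (fRow H 1 + fRow H 2) +
      Matrix.vecMulVec (beam (H 4)) (gRow H 1 + gRow H 2)
  -- The `e₀` part is what receiver 1 saw in slot 4 beyond its own f and g, so receiver 1 cancels it
  -- with slot 4; receiver 2 computes it from its own f and g; receiver 0 gains an equation.
  | 5 => Matrix.vecMulVec e₀ (H 4 1 0 • fRow H 2 + gain (H 4) 1 • gRow H 2) +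
      Matrix.vecMulVec (beam (H 5)) ((H 2 1 0 * H 2 2 0) • rowC)
  | 6 => Matrix.vecMulVec e₀ (H 4 2 0 • fRow H 1 + gain (H 4) 2 • gRow H 1) +
      Matrix.vecMulVec (beam (H 6)) ((H 3 1 0 * H 3 2 0) • rowD)
  -- The new symbol is nulled at receivers 1 and 2, and each f is nulled at the receiver that does
  -- not want it.
  | 7 => Matrix.vecMulVec (H 7 1 ⨯₃ H 7 2) rowE + Matrix.vecMulVec (H 7 2 ⨯₃ e₀) (fRow H 1) +
      Matrix.vecMulVec (H 7 1 ⨯₃ e₀) (fRow H 2)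
  | 8 => Matrix.vecMulVec (H 8 2 ⨯₃ e₀) (gRow H 1) + Matrix.vecMulVec (H 8 1 ⨯₃ e₀) (gRow H 2)

/-- The precoders for receiver `i`, where `i` is `1` or `2` and `j` is the other one of the two. -/
def precoder (i j : Fin 3) (H : ChannelSeq 9) : Fin 9 → Matrix (Fin 3) (Fin 4) ℂ
  | 0 => Matrix.vecMulVec (H 0 0 ⨯₃ e₀) (Pi.single 0 1) +
      Matrix.vecMulVec (H 0 0 ⨯₃ e₁) (Pi.single 1 1)
  | 1 => Matrix.vecMulVec (H 1 0 ⨯₃ e₀) (Pi.single 2 1) +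
      Matrix.vecMulVec (H 1 0 ⨯₃ e₁) (Pi.single 3 1)
  -- The unintended receiver `j` already has this combination as interference; receiver `i` lacks
  -- it.
  | 2 => Matrix.vecMulVec (beam (H 2)) (pairRow (H 0) j)
  | 3 => Matrix.vecMulVec (beam (H 3)) (pairRow' (H 1) j)
  | 4 => 0
  | 5 => Matrix.vecMulVec (beam (H 5)) ((H 2 i 0 * gain (H 2) j) • pairRow (H 0) j)
  | 6 => Matrix.vecMulVec (beam (H 6)) ((H 3 i 0 * gain (H 3) j) • pairRow' (H 1) j)
  | 7 => 0
  | 8 => 0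

/-! #### Measurability and causality -/

@[fun_prop]
theorem continuous_cross {X : Type*} [TopologicalSpace X] {f g : X → Fin 3 → ℂ}
    (hf : Continuous f) (hg : Continuous g) : Continuous fun x => f x ⨯₃ g x := by
  simp only [cross_apply]
  refine continuous_pi fun i => ?_
  fin_cases i <;> simp <;> fun_prop

@[fun_prop]
theorem continuous_rowA {X : Type*} [TopologicalSpace X] {f : X → Fin 3 → ℂ}
    (hf : Continuous f) : Continuous fun x => rowA (f x) := by
  simp only [rowA]; fun_prop

@[fun_prop]
theorem continuous_rowB {X : Type*} [TopologicalSpace X] {f : X → Fin 3 → ℂ}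
    (hf : Continuous f) : Continuous fun x => rowB (f x) := by
  simp only [rowB]; fun_prop

@[fun_prop]
theorem continuous_beam {X : Type*} [TopologicalSpace X] {f : X → Fin 3 → Fin 3 → ℂ}
    (hf : Continuous f) : Continuous fun x => beam (f x) := by
  simp only [beam]; fun_prop

@[fun_prop]
theorem continuous_gain {X : Type*} [TopologicalSpace X] {f : X → Fin 3 → Fin 3 → ℂ}
    (hf : Continuous f) (i : Fin 3) : Continuous fun x => gain (f x) i := by
  simp only [gain, dotProduct]; fun_prop

@[fun_prop]
theorem continuous_fRow (i : Fin 3) : Continuous fun H => fRow H i := by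
  simp only [fRow]; fun_prop

@[fun_prop]
theorem continuous_gRow (i : Fin 3) : Continuous fun H => gRow H i := by
  simp only [gRow]; fun_prop

@[fun_prop]
theorem continuous_pairRow {X : Type*} [TopologicalSpace X] {f : X → Fin 3 → Fin 3 → ℂ}
    (hf : Continuous f) (i : Fin 3) : Continuous fun x => pairRow (f x) i := by
  simp only [pairRow, dotProduct]; fun_prop

@[fun_prop]
theorem continuous_pairRow' {X : Type*} [TopologicalSpace X] {f : X → Fin 3 → Fin 3 → ℂ}
    (hf : Continuous f) (i : Fin 3) : Continuous fun x => pairRow' (f x) i := by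
  simp only [pairRow', dotProduct]; fun_prop

@[fun_prop]
theorem continuous_vecMulVec {X m n : Type*} [TopologicalSpace X] {f : X → m → ℂ} {g : X → n → ℂ}
    (hf : Continuous f) (hg : Continuous g) : Continuous fun x => Matrix.vecMulVec (f x) (g x) :=
  hf.matrix_vecMulVec hg

theorem continuous_precoder₀ : ∀ t : Fin 9, Continuous fun H => precoder₀ H t
  | 0 | 1 | 2 | 3 | 4 | 5 | 6 | 7 | 8 => by simp only [precoder₀]; fun_prop

theorem continuous_precoder (i j : Fin 3) : ∀ t : Fin 9, Continuous fun H => precoder i j H t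
  | 0 | 1 | 2 | 3 | 4 | 5 | 6 | 7 | 8 => by simp only [precoder]; fun_prop

theorem known_perfect {t s : ℕ} (hs : s < 7) (h : s ≤ t) : Known alternatingCSIT t s 0 := by
  left
  simp [alternatingCSIT, hybridState, Nat.mod_eq_of_lt (show s < 9 by omega), hs, h]

theorem known_delayed {t s : ℕ} (hs : s < 7) (h : s < t) (i : Fin 3) :
    Known alternatingCSIT t s i := by
  fin_cases i <;>
    simp [Known, alternatingCSIT, hybridState, Nat.mod_eq_of_lt (show s < 9 by omega), hs, h, h.le]

theorem known_npp {t s : ℕ} (hs : 7 ≤ s) (hs' : s < 9) (h : s ≤ t) {i : Fin 3} (hi : i ≠ 0) :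
    Known alternatingCSIT t s i := by
  left
  fin_cases i
  · exact absurd rfl hi
  all_goals
    simp [alternatingCSIT, nppState, Nat.mod_eq_of_lt hs', not_lt.2 hs, h]

theorem isCausal_precoder₀ : IsCausal alternatingCSIT precoder₀ := by
  intro t H H' h
  have hp : ∀ s : Fin 9, s < 7 → s ≤ t → H s 0 = H' s 0 := fun s h1 h2 =>
    h s 0 (known_perfect h1 h2)
  have hd : ∀ s : Fin 9, s < 7 → s < t → H s = H' s := fun s h1 h2 =>
    funext fun i => h s i (known_delayed h1 h2 i)
  have hn : ∀ s : Fin 9, 7 ≤ s → s ≤ t → ∀ i, i ≠ 0 → H s i = H' s i := fun s h1 h2 i hi =>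
    h s i (known_npp h1 s.2 h2 hi)
  have hf : 3 ≤ t → ∀ i, fRow H i = fRow H' i := fun ht i => by
    simp only [fRow, hd 0 (by decide) (lt_of_lt_of_le (by decide) ht),
      hd 2 (by decide) (lt_of_lt_of_le (by decide) ht)]
  have hg : 4 ≤ t → ∀ i, gRow H i = gRow H' i := fun ht i => by
    simp only [gRow, hd 1 (by decide) (lt_of_lt_of_le (by decide) ht),
      hd 3 (by decide) (lt_of_lt_of_le (by decide) ht)]
  match t with
  | 0 | 1 | 2 | 3 => rfl
  | 4 => simp only [precoder₀, beam, hf (by decide), hg (by decide), hp 4 (by decide) (by decide)]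
  | 5 => simp only [precoder₀, beam, hf (by decide), hg (by decide), hp 5 (by decide) (by decide),
      hd 2 (by decide) (by decide), hd 4 (by decide) (by decide)]
  | 6 => simp only [precoder₀, beam, hf (by decide), hg (by decide), hp 6 (by decide) (by decide),
      hd 3 (by decide) (by decide), hd 4 (by decide) (by decide)]
  | 7 => simp only [precoder₀, hf (by decide), hn 7 (by decide) (by decide) 1 (by decide),
      hn 7 (by decide) (by decide) 2 (by decide)]
  | 8 => simp only [precoder₀, hg (by decide), hn 8 (by decide) (by decide) 1 (by decide),
      hn 8 (by decide) (by decide) 2 (by decide)]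

theorem isCausal_precoder (i j : Fin 3) : IsCausal alternatingCSIT (precoder i j) := by
  intro t H H' h
  have hp : ∀ s : Fin 9, s < 7 → s ≤ t → H s 0 = H' s 0 := fun s h1 h2 =>
    h s 0 (known_perfect h1 h2)
  have hd : ∀ s : Fin 9, s < 7 → s < t → H s = H' s := fun s h1 h2 =>
    funext fun i => h s i (known_delayed h1 h2 i)
  match t with
  | 0 => simp only [precoder, hp 0 (by decide) (by decide)]
  | 1 => simp only [precoder, hp 1 (by decide) (by decide)]
  | 2 => simp only [precoder, beam, hp 2 (by decide) (by decide), hd 0 (by decide) (by decide)]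
  | 3 => simp only [precoder, beam, hp 3 (by decide) (by decide), hd 1 (by decide) (by decide)]
  | 4 | 7 | 8 => rfl
  | 5 => simp only [precoder, beam, hp 5 (by decide) (by decide), hd 0 (by decide) (by decide),
      hd 2 (by decide) (by decide)]
  | 6 => simp only [precoder, beam, hp 6 (by decide) (by decide), hd 1 (by decide) (by decide),
      hd 3 (by decide) (by decide)]

/-! #### Regular channels -/

/-- The nondegeneracy of the channels in one slot that the scheme needs. -/
structure SlotRegular (h : Fin 3 → Fin 3 → ℂ) : Prop where
  coord_zero : ∀ i, h i 0 ≠ 0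
  coord_two : ∀ i, h i 2 ≠ 0
  gain_ne_zero : ∀ i, i ≠ 0 → gain h i ≠ 0
  gain_det : h 1 0 * gain h 2 - h 2 0 * gain h 1 ≠ 0
  triple : h 1 ⬝ᵥ (h 2 ⨯₃ e₀) ≠ 0
  det : h 0 ⬝ᵥ (h 1 ⨯₃ h 2) ≠ 0

/-- The nondegeneracy across slots `4` and `8` that the first receiver needs. -/
def SeparatesSlots (H : ChannelSeq 9) : Prop :=
  H 8 0 ⬝ᵥ ((H 4 1 0 * gain (H 4) 2) • (H 8 1 ⨯₃ e₀) - (H 4 2 0 * gain (H 4) 1) • (H 8 2 ⨯₃ e₀)) ≠ 0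

theorem dotProduct_e₀ (h : Fin 3 → ℂ) : h ⬝ᵥ e₀ = h 0 := by
  simp [dotProduct, Fin.sum_univ_three, e₀]

theorem cross_e₀ (h : Fin 3 → ℂ) : h ⨯₃ e₀ = ![0, h 2, -h 1] := by
  simp [cross_apply, e₀]

theorem cross_e₀_ne_zero {h : Fin 3 → ℂ} (hh : h 2 ≠ 0) : h ⨯₃ e₀ ≠ 0 := by
  intro e
  rw [cross_e₀] at e
  exact hh (by simpa using congrFun e 1)

section
variable {ν : Fin 3 → Measure (Fin 3 → ℂ)} [∀ i, IsProbabilityMeasure (ν i)]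

/-- Every condition is linear in one row of `H t`, with a coefficient vector built from the other
rows that is nonzero by a condition established before it; this dictates the order of the proof. -/
theorem ae_slotRegular (hgen : ∀ i, IsGeneric (ν i)) {n : ℕ} :
    ∀ᵐ H ∂(channelLaw ν n), ∀ t, SlotRegular (H t) := by
  rw [ae_all_iff]
  intro t
  have h0 : ∀ i, ∀ᵐ H ∂(channelLaw ν n), H t i 0 ≠ 0 := fun i => by
    have := ae_dotProduct_ne_zero hgen t i (fun _ => e₀) measurable_const (fun _ _ => rfl)
      (ae_of_all _ fun _ e => by simpa [e₀] using congrFun e 0)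
    simpa only [dotProduct_e₀] using this
  have h2 : ∀ i, ∀ᵐ H ∂(channelLaw ν n), H t i 2 ≠ 0 := fun i => by
    have := ae_dotProduct_ne_zero hgen t i (fun _ => Pi.single 2 1) measurable_const
      (fun _ _ => rfl) (ae_of_all _ fun _ e => by simpa using congrFun e 2)
    simpa using this
  have hg : ∀ i, i ≠ 0 → ∀ᵐ H ∂(channelLaw ν n), gain (H t) i ≠ 0 := fun i hi => by
    refine ae_dotProduct_ne_zero hgen t i (fun H => beam (H t))
      (by fun_prop : Continuous fun H : ChannelSeq n => beam (H t)).measurable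
      (fun H v => by simp [beam, Function.update_of_ne hi.symm]) ?_
    filter_upwards [h2 0] with H hH using cross_e₀_ne_zero hH
  have hd : ∀ᵐ H ∂(channelLaw ν n), H t 1 0 * gain (H t) 2 - H t 2 0 * gain (H t) 1 ≠ 0 := by
    have := ae_dotProduct_ne_zero hgen t 1
      (fun H => gain (H t) 2 • e₀ - H t 2 0 • beam (H t))
      (by fun_prop : Continuous fun H : ChannelSeq n =>
        gain (H t) 2 • e₀ - H t 2 0 • beam (H t)).measurable
      (fun H v => by simp [beam, gain]) (by
        filter_upwards [hg 2 (by decide)] with H hH e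
        -- `beam` has zero first coordinate, so only the gain of receiver 2 remains there.
        have := congrFun e 0
        rw [beam, cross_e₀] at this
        exact hH (by simpa [e₀] using this))
    filter_upwards [this] with H hH
    rw [dotProduct_sub, dotProduct_smul, dotProduct_smul, dotProduct_e₀] at hH
    simpa [gain, mul_comm] using hH
  have ht : ∀ᵐ H ∂(channelLaw ν n), H t 1 ⬝ᵥ (H t 2 ⨯₃ e₀) ≠ 0 := by
    refine ae_dotProduct_ne_zero hgen t 1 (fun H => H t 2 ⨯₃ e₀)
      (by fun_prop : Continuous fun H : ChannelSeq n => H t 2 ⨯₃ e₀).measurable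
      (fun H v => by simp) ?_
    filter_upwards [h2 2] with H hH using cross_e₀_ne_zero hH
  have hdet : ∀ᵐ H ∂(channelLaw ν n), H t 0 ⬝ᵥ (H t 1 ⨯₃ H t 2) ≠ 0 := by
    refine ae_dotProduct_ne_zero hgen t 0 (fun H => H t 1 ⨯₃ H t 2)
      (by fun_prop : Continuous fun H : ChannelSeq n => H t 1 ⨯₃ H t 2).measurable
      (fun H v => by simp) ?_
    filter_upwards [ht] with H hH e
    rw [triple_product_permutation, triple_product_permutation, e, dotProduct_zero] at hH
    exact hH rfl
  filter_upwards [ae_all_iff.2 h0, ae_all_iff.2 h2, hg 1 (by decide), hg 2 (by decide), hd, ht,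
    hdet] with H h0 h2 hg1 hg2 hd ht hdet
  refine ⟨h0, h2, fun i hi => ?_, hd, ht, hdet⟩
  fin_cases i
  · exact absurd rfl hi
  · exact hg1
  · exact hg2

theorem ae_separatesSlots (hgen : ∀ i, IsGeneric (ν i)) :
    ∀ᵐ H ∂(channelLaw ν 9), SeparatesSlots H := by
  refine ae_dotProduct_ne_zero hgen 8 0 (fun H => (H 4 1 0 * gain (H 4) 2) • (H 8 1 ⨯₃ e₀) -
    (H 4 2 0 * gain (H 4) 1) • (H 8 2 ⨯₃ e₀)) (Continuous.measurable (by fun_prop))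
    (fun H v => ?_) ?_
  · simp
  · filter_upwards [ae_slotRegular hgen] with H hH e
    -- Pairing with `H 8 1` kills the first cross product and leaves a multiple of the triple
    -- product of slot 8.
    have := congrArg (fun x => H 8 1 ⬝ᵥ x) e
    simp only [dotProduct_sub, dotProduct_smul, dot_self_cross, dotProduct_zero, smul_eq_mul,
      mul_zero, zero_sub, neg_eq_zero, mul_eq_zero] at this
    exact this.elim (fun h => h.elim ((hH 4).coord_zero 2) ((hH 4).gain_ne_zero 1 (by decide)))
      (hH 8).triple

end

/-! #### Decoding -/

theorem dotProduct_vecMulVec_mulVec {m n : Type*} [Fintype m] [Fintype n] (x w : m → ℂ)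
    (v s : n → ℂ) : x ⬝ᵥ (Matrix.vecMulVec w v *ᵥ s) = x ⬝ᵥ w * v ⬝ᵥ s := by
  rw [Matrix.vecMulVec_mulVec, dotProduct_smul, op_smul_eq_mul]

theorem rowA_dotProduct (h : Fin 3 → ℂ) (s : Fin 9 → ℂ) :
    rowA h ⬝ᵥ s = h ⬝ᵥ ![s 0, s 1, s 2] := by
  simp only [rowA, add_dotProduct, smul_dotProduct, single_one_dotProduct]
  simp [dotProduct, Fin.sum_univ_three]

theorem rowB_dotProduct (h : Fin 3 → ℂ) (s : Fin 9 → ℂ) :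
    rowB h ⬝ᵥ s = h ⬝ᵥ ![s 3, s 4, s 5] := by
  simp only [rowB, add_dotProduct, smul_dotProduct, single_one_dotProduct]
  simp [dotProduct, Fin.sum_univ_three]

theorem dotProduct_rowA_mulVec (h : Fin 3 → ℂ) (s : Fin 9 → ℂ) :
    h ⬝ᵥ (Matrix.of (fun a => rowA (Pi.single a 1)) *ᵥ s) = rowA h ⬝ᵥ s := by
  rw [rowA_dotProduct]
  congr 1
  ext a
  change rowA (Pi.single a 1) ⬝ᵥ s = _
  rw [rowA_dotProduct, single_one_dotProduct]

theorem dotProduct_rowB_mulVec (h : Fin 3 → ℂ) (s : Fin 9 → ℂ) :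
    h ⬝ᵥ (Matrix.of (fun a => rowB (Pi.single a 1)) *ᵥ s) = rowB h ⬝ᵥ s := by
  rw [rowB_dotProduct]
  congr 1
  ext a
  change rowB (Pi.single a 1) ⬝ᵥ s = _
  rw [rowB_dotProduct, single_one_dotProduct]

theorem eq_zero_of_dotProduct_eq_zero {h : Fin 3 → Fin 3 → ℂ}
    (hdet : h 0 ⬝ᵥ (h 1 ⨯₃ h 2) ≠ 0) {x : Fin 3 → ℂ} (hx : ∀ i, h i ⬝ᵥ x = 0) : x = 0 := by
  refine Matrix.eq_zero_of_mulVec_eq_zero (M := Matrix.of h) ?_ (funext hx)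
  rw [triple_product_eq_det] at hdet
  have e : (Matrix.of h : Matrix (Fin 3) (Fin 3) ℂ) = ![h 0, h 1, h 2] := by
    ext i j
    fin_cases i <;> rfl
  rwa [e]

theorem pairRow_dotProduct (h : Fin 3 → Fin 3 → ℂ) (i : Fin 3) (s : Fin 4 → ℂ) :
    pairRow h i ⬝ᵥ s = h i ⬝ᵥ (h 0 ⨯₃ e₀) * s 0 + h i ⬝ᵥ (h 0 ⨯₃ e₁) * s 1 := by
  simp only [pairRow, add_dotProduct, smul_dotProduct, single_one_dotProduct, smul_eq_mul]

theorem pairRow'_dotProduct (h : Fin 3 → Fin 3 → ℂ) (i : Fin 3) (s : Fin 4 → ℂ) :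
    pairRow' h i ⬝ᵥ s = h i ⬝ᵥ (h 0 ⨯₃ e₀) * s 2 + h i ⬝ᵥ (h 0 ⨯₃ e₁) * s 3 := by
  simp only [pairRow', add_dotProduct, smul_dotProduct, single_one_dotProduct, smul_eq_mul]

/-- The two beams span vectors orthogonal to `h 0`, so vanishing at receivers 1 and 2 means
orthogonality to a basis. The beams are independent because `h 0 2 ≠ 0`. -/
theorem pair_eq_zero {h : Fin 3 → Fin 3 → ℂ} (hh : SlotRegular h) {x y : ℂ}
    (hx : ∀ i, i ≠ 0 → h i ⬝ᵥ (h 0 ⨯₃ e₀) * x + h i ⬝ᵥ (h 0 ⨯₃ e₁) * y = 0) : x = 0 ∧ y = 0 := by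
  have key : x • (h 0 ⨯₃ e₀) + y • (h 0 ⨯₃ e₁) = 0 := by
    refine eq_zero_of_dotProduct_eq_zero hh.det fun i => ?_
    rw [dotProduct_add, dotProduct_smul, dotProduct_smul, smul_eq_mul, smul_eq_mul]
    by_cases hi : i = 0
    · subst hi; simp
    · linear_combination hx i hi
  have k0 := congrFun key 0
  have k1 := congrFun key 1
  simp [cross_apply, e₀, e₁, hh.coord_two 0] at k0 k1
  exact ⟨k1, k0⟩

/-- The noise-free output of receiver `j` in slot `t`. -/
def slotOutput (H : ChannelSeq 9) (s₀ : Fin 9 → ℂ) (s₁ s₂ : Fin 4 → ℂ) (t : Fin 9) (j : Fin 3) : ℂ :=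
  H t j ⬝ᵥ (precoder₀ H t *ᵥ s₀ + precoder 1 2 H t *ᵥ s₁ + precoder 2 1 H t *ᵥ s₂)

section outputs
variable (H : ChannelSeq 9) (s₀ : Fin 9 → ℂ) (s₁ s₂ : Fin 4 → ℂ) (j : Fin 3)

theorem slotOutput_zero : slotOutput H s₀ s₁ s₂ 0 j =
    rowA (H 0 j) ⬝ᵥ s₀ + pairRow (H 0) j ⬝ᵥ s₁ + pairRow (H 0) j ⬝ᵥ s₂ := by
  simp only [slotOutput, precoder₀, precoder, dotProduct_add, dotProduct_rowA_mulVec,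
    Matrix.add_mulVec, dotProduct_vecMulVec_mulVec, single_one_dotProduct, pairRow_dotProduct]

theorem slotOutput_one : slotOutput H s₀ s₁ s₂ 1 j =
    rowB (H 1 j) ⬝ᵥ s₀ + pairRow' (H 1) j ⬝ᵥ s₁ + pairRow' (H 1) j ⬝ᵥ s₂ := by
  simp only [slotOutput, precoder₀, precoder, dotProduct_add, dotProduct_rowB_mulVec,
    Matrix.add_mulVec, dotProduct_vecMulVec_mulVec, single_one_dotProduct, pairRow'_dotProduct]

theorem slotOutput_two : slotOutput H s₀ s₁ s₂ 2 j = H 2 j 0 * s₀ 6 +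
    gain (H 2) j * (pairRow (H 0) 2 ⬝ᵥ s₁ + pairRow (H 0) 1 ⬝ᵥ s₂) := by
  simp only [slotOutput, precoder₀, precoder, dotProduct_add, dotProduct_vecMulVec_mulVec,
    dotProduct_e₀, rowC, single_one_dotProduct, gain]
  ring

theorem slotOutput_three : slotOutput H s₀ s₁ s₂ 3 j = H 3 j 0 * s₀ 7 +
    gain (H 3) j * (pairRow' (H 1) 2 ⬝ᵥ s₁ + pairRow' (H 1) 1 ⬝ᵥ s₂) := by
  simp only [slotOutput, precoder₀, precoder, dotProduct_add, dotProduct_vecMulVec_mulVec,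
    dotProduct_e₀, rowD, single_one_dotProduct, gain]
  ring

theorem slotOutput_four : slotOutput H s₀ s₁ s₂ 4 j =
    H 4 j 0 * (fRow H 1 ⬝ᵥ s₀ + fRow H 2 ⬝ᵥ s₀) +
      gain (H 4) j * (gRow H 1 ⬝ᵥ s₀ + gRow H 2 ⬝ᵥ s₀) := by
  simp only [slotOutput, precoder₀, precoder, dotProduct_add, dotProduct_vecMulVec_mulVec,
    dotProduct_e₀, gain, Matrix.add_mulVec, add_dotProduct, Matrix.zero_mulVec, add_zero]

theorem slotOutput_five : slotOutput H s₀ s₁ s₂ 5 j =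
    H 5 j 0 * (H 4 1 0 * fRow H 2 ⬝ᵥ s₀ + gain (H 4) 1 * gRow H 2 ⬝ᵥ s₀) +
      gain (H 5) j * (H 2 1 0 * H 2 2 0 * s₀ 6 +
        H 2 1 0 * gain (H 2) 2 * pairRow (H 0) 2 ⬝ᵥ s₁ +
        H 2 2 0 * gain (H 2) 1 * pairRow (H 0) 1 ⬝ᵥ s₂) := by
  simp only [slotOutput, precoder₀, precoder, dotProduct_add, dotProduct_vecMulVec_mulVec,
    dotProduct_e₀, rowC, single_one_dotProduct, Matrix.add_mulVec, add_dotProduct,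
    smul_dotProduct, smul_eq_mul]
  rw [← gain]
  ring

theorem slotOutput_six : slotOutput H s₀ s₁ s₂ 6 j =
    H 6 j 0 * (H 4 2 0 * fRow H 1 ⬝ᵥ s₀ + gain (H 4) 2 * gRow H 1 ⬝ᵥ s₀) +
      gain (H 6) j * (H 3 1 0 * H 3 2 0 * s₀ 7 +
        H 3 1 0 * gain (H 3) 2 * pairRow' (H 1) 2 ⬝ᵥ s₁ +
        H 3 2 0 * gain (H 3) 1 * pairRow' (H 1) 1 ⬝ᵥ s₂) := by
  simp only [slotOutput, precoder₀, precoder, dotProduct_add, dotProduct_vecMulVec_mulVec,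
    dotProduct_e₀, rowD, single_one_dotProduct, Matrix.add_mulVec, add_dotProduct,
    smul_dotProduct, smul_eq_mul]
  rw [← gain]
  ring

theorem slotOutput_seven : slotOutput H s₀ s₁ s₂ 7 j =
    H 7 j ⬝ᵥ (H 7 1 ⨯₃ H 7 2) * s₀ 8 + H 7 j ⬝ᵥ (H 7 2 ⨯₃ e₀) * fRow H 1 ⬝ᵥ s₀ +
      H 7 j ⬝ᵥ (H 7 1 ⨯₃ e₀) * fRow H 2 ⬝ᵥ s₀ := by
  simp only [slotOutput, precoder₀, precoder, dotProduct_add, dotProduct_vecMulVec_mulVec,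
    rowE, single_one_dotProduct, Matrix.add_mulVec, Matrix.zero_mulVec, add_zero]

theorem slotOutput_eight : slotOutput H s₀ s₁ s₂ 8 j =
    H 8 j ⬝ᵥ (H 8 2 ⨯₃ e₀) * gRow H 1 ⬝ᵥ s₀ + H 8 j ⬝ᵥ (H 8 1 ⨯₃ e₀) * gRow H 2 ⬝ᵥ s₀ := by
  simp only [slotOutput, precoder₀, precoder, dotProduct_add, dotProduct_vecMulVec_mulVec,
    Matrix.add_mulVec, Matrix.zero_mulVec, add_zero]

end outputs

theorem fRow_dotProduct (H : ChannelSeq 9) (i : Fin 3) (s : Fin 9 → ℂ) :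
    fRow H i ⬝ᵥ s = H 2 i 0 * s 6 - gain (H 2) i * rowA (H 0 i) ⬝ᵥ s := by
  simp [fRow, rowC, sub_dotProduct]

theorem gRow_dotProduct (H : ChannelSeq 9) (i : Fin 3) (s : Fin 9 → ℂ) :
    gRow H i ⬝ᵥ s = H 3 i 0 * s 7 - gain (H 3) i * rowB (H 1 i) ⬝ᵥ s := by
  simp [gRow, rowD, sub_dotProduct]

theorem gain_zero (h : Fin 3 → Fin 3 → ℂ) : gain h 0 = 0 := by simp [gain, beam]

theorem pairRow_zero (h : Fin 3 → Fin 3 → ℂ) : pairRow h 0 = 0 := by simp [pairRow]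

theorem pairRow'_zero (h : Fin 3 → Fin 3 → ℂ) : pairRow' h 0 = 0 := by simp [pairRow']

/-- Nulling leaves nine equations in nine unknowns. Slots 2 and 3 give c and d; slots 4, 5, 6, 8
form a 4 × 4 system for the f's and g's, nonsingular by `SeparatesSlots`; slot 7 gives the last
symbol. Then A and B are each seen through three independent rows. -/
theorem decode_first {H : ChannelSeq 9} (hr : ∀ t, SlotRegular (H t)) (hs : SeparatesSlots H)
    {s₀ : Fin 9 → ℂ} {s₁ s₂ : Fin 4 → ℂ} (hy : ∀ t, slotOutput H s₀ s₁ s₂ t 0 = 0) : s₀ = 0 := by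
  have y0 := hy 0
  have y1 := hy 1
  have y2 := hy 2
  have y3 := hy 3
  have y4 := hy 4
  have y5 := hy 5
  have y6 := hy 6
  have y7 := hy 7
  have y8 := hy 8
  rw [slotOutput_zero, pairRow_zero, zero_dotProduct, zero_dotProduct, add_zero, add_zero] at y0
  rw [slotOutput_one, pairRow'_zero, zero_dotProduct, zero_dotProduct, add_zero, add_zero] at y1
  rw [slotOutput_two, gain_zero, zero_mul, add_zero] at y2
  rw [slotOutput_three, gain_zero, zero_mul, add_zero] at y3
  rw [slotOutput_four, gain_zero, zero_mul, add_zero] at y4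
  rw [slotOutput_five, gain_zero, zero_mul, add_zero] at y5
  rw [slotOutput_six, gain_zero, zero_mul, add_zero] at y6
  rw [slotOutput_seven] at y7
  rw [slotOutput_eight] at y8
  have c0 := (mul_eq_zero.1 y2).resolve_left ((hr 2).coord_zero 0)
  have d0 := (mul_eq_zero.1 y3).resolve_left ((hr 3).coord_zero 0)
  replace y4 := (mul_eq_zero.1 y4).resolve_left ((hr 4).coord_zero 0)
  replace y5 := (mul_eq_zero.1 y5).resolve_left ((hr 5).coord_zero 0)
  replace y6 := (mul_eq_zero.1 y6).resolve_left ((hr 6).coord_zero 0)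
  have f1 : fRow H 1 ⬝ᵥ s₀ = 0 := by
    refine (mul_eq_zero.1 (?_ : _ * fRow H 1 ⬝ᵥ s₀ = 0)).resolve_left hs
    rw [dotProduct_sub, dotProduct_smul, dotProduct_smul, smul_eq_mul, smul_eq_mul]
    -- Slots 6 and 5 eliminate the two g's from slot 8, and slot 4 eliminates f_2; the coefficient
    -- left on f_1 is the expression in `SeparatesSlots`.
    linear_combination (gain (H 4) 1 * gain (H 4) 2) * y8
      - (gain (H 4) 1 * H 8 0 ⬝ᵥ (H 8 2 ⨯₃ e₀)) * y6
      - (gain (H 4) 2 * H 8 0 ⬝ᵥ (H 8 1 ⨯₃ e₀)) * y5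
      + (gain (H 4) 2 * H 4 1 0 * H 8 0 ⬝ᵥ (H 8 1 ⨯₃ e₀)) * y4
  have f2 : fRow H 2 ⬝ᵥ s₀ = 0 := by linear_combination y4 - f1
  have g1 : gRow H 1 ⬝ᵥ s₀ = 0 := by
    refine (mul_eq_zero.1 (?_ : gain (H 4) 2 * _ = 0)).resolve_left
      ((hr 4).gain_ne_zero 2 (by decide))
    linear_combination y6 - H 4 2 0 * f1
  have g2 : gRow H 2 ⬝ᵥ s₀ = 0 := by
    refine (mul_eq_zero.1 (?_ : gain (H 4) 1 * _ = 0)).resolve_left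
      ((hr 4).gain_ne_zero 1 (by decide))
    linear_combination y5 - H 4 1 0 * f2
  have ee : s₀ 8 = 0 := by
    rw [f1, f2, mul_zero, mul_zero, add_zero, add_zero] at y7
    exact (mul_eq_zero.1 y7).resolve_left (hr 7).det
  rw [fRow_dotProduct, c0, mul_zero, zero_sub, neg_eq_zero] at f1 f2
  rw [gRow_dotProduct, d0, mul_zero, zero_sub, neg_eq_zero] at g1 g2
  have a1 := (mul_eq_zero.1 f1).resolve_left ((hr 2).gain_ne_zero 1 (by decide))
  have a2 := (mul_eq_zero.1 f2).resolve_left ((hr 2).gain_ne_zero 2 (by decide))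
  have b1 := (mul_eq_zero.1 g1).resolve_left ((hr 3).gain_ne_zero 1 (by decide))
  have b2 := (mul_eq_zero.1 g2).resolve_left ((hr 3).gain_ne_zero 2 (by decide))
  rw [rowA_dotProduct] at y0 a1 a2
  rw [rowB_dotProduct] at y1 b1 b2
  have ha := eq_zero_of_dotProduct_eq_zero (hr 0).det (Fin.forall_fin_succ.2
    ⟨y0, Fin.forall_fin_two.2 ⟨a1, a2⟩⟩)
  have hb := eq_zero_of_dotProduct_eq_zero (hr 1).det (Fin.forall_fin_succ.2
    ⟨y1, Fin.forall_fin_two.2 ⟨b1, b2⟩⟩)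
  have ha0 : s₀ 0 = 0 := congrFun ha 0
  have ha1 : s₀ 1 = 0 := congrFun ha 1
  have ha2 : s₀ 2 = 0 := congrFun ha 2
  have hb0 : s₀ 3 = 0 := congrFun hb 0
  have hb1 : s₀ 4 = 0 := congrFun hb 1
  have hb2 : s₀ 5 = 0 := congrFun hb 2
  funext i
  match i with
  | 0 => exact ha0
  | 1 => exact ha1
  | 2 => exact ha2
  | 3 => exact hb0
  | 4 => exact hb1
  | 5 => exact hb2
  | 6 => exact c0
  | 7 => exact d0
  | 8 => exact ee

/-- How receiver `i` removes the aligned interference: `a`, `a'` and `g`, `g'` are the gains of the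
two receivers, `c` and `A` are symbols for the first receiver, `u`, `u'` what the two receivers see
of the desired symbols, and `v` what receiver `i` sees of the symbols for the other one. -/
theorem unalign {a a' g g' l c A u u' v : ℂ} (hg : g ≠ 0) (hl : l ≠ 0)
    (hd : a * g' - a' * g ≠ 0) (hf : a * c - g * A = 0) (h0 : A + u + v = 0)
    (h2 : a * c + g * (u' + v) = 0) (h5 : l * (a * a' * c + a * g' * u' + a' * g * v) = 0) :
    u = 0 ∧ u' = 0 := by
  have h2' : A + u' + v = 0 := by
    refine (mul_eq_zero.1 (?_ : g * _ = 0)).resolve_left hg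
    linear_combination h2 - hf
  have hu' : u' = 0 := by
    refine (mul_eq_zero.1 (?_ : _ * u' = 0)).resolve_left hd
    -- Subtracting `hf` trades `c` for `A`, and `A + v` is known from `h2'` up to `u'`. Only `u'`
    -- survives, with coefficient `a * g' - a' * g`.
    linear_combination (mul_eq_zero.1 h5).resolve_left hl - a' * hf - a' * g * h2'
  exact ⟨by linear_combination h0 - h2' + hu', hu'⟩

theorem symbols_eq_zero {H : ChannelSeq 9} (hr : ∀ t, SlotRegular (H t)) {s : Fin 4 → ℂ}
    (h : ∀ i, i ≠ 0 → pairRow (H 0) i ⬝ᵥ s = 0) (h' : ∀ i, i ≠ 0 → pairRow' (H 1) i ⬝ᵥ s = 0) :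
    s = 0 := by
  simp only [pairRow_dotProduct] at h
  simp only [pairRow'_dotProduct] at h'
  obtain ⟨h0, h1⟩ := pair_eq_zero (hr 0) h
  obtain ⟨h2, h3⟩ := pair_eq_zero (hr 1) h'
  funext i
  match i with
  | 0 => exact h0
  | 1 => exact h1
  | 2 => exact h2
  | 3 => exact h3

/-- The five interference dimensions are f_1, g_1, the combination of f_2 and g_2 shared by slots 4
and 5, and one aligned sum in each of slots 0 and 1. This leaves four dimensions for the desired
symbols. -/
theorem decode_second {H : ChannelSeq 9} (hr : ∀ t, SlotRegular (H t))
    {s₀ : Fin 9 → ℂ} {s₁ s₂ : Fin 4 → ℂ} (hy : ∀ t, slotOutput H s₀ s₁ s₂ t 1 = 0) : s₁ = 0 := by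
  have y0 := hy 0
  have y1 := hy 1
  have y2 := hy 2
  have y3 := hy 3
  have y4 := hy 4
  have y5 := hy 5
  have y6 := hy 6
  have y7 := hy 7
  have y8 := hy 8
  rw [slotOutput_zero] at y0
  rw [slotOutput_one] at y1
  rw [slotOutput_two] at y2
  rw [slotOutput_three] at y3
  rw [slotOutput_four] at y4
  rw [slotOutput_five] at y5
  rw [slotOutput_six] at y6
  rw [slotOutput_seven, dot_self_cross, dot_self_cross, zero_mul, zero_mul, zero_add,
    add_zero] at y7
  rw [slotOutput_eight, dot_self_cross, zero_mul, add_zero] at y8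
  have f1 := (mul_eq_zero.1 y7).resolve_left (hr 7).triple
  have g1 := (mul_eq_zero.1 y8).resolve_left (hr 8).triple
  rw [f1, g1, mul_zero, mul_zero, add_zero, mul_zero, zero_add] at y6
  rw [f1, g1, zero_add, zero_add] at y4
  rw [y4, mul_zero, zero_add] at y5
  rw [fRow_dotProduct] at f1
  rw [gRow_dotProduct] at g1
  obtain ⟨u1, u2⟩ := unalign ((hr 2).gain_ne_zero 1 (by decide))
    ((hr 5).gain_ne_zero 1 (by decide)) (hr 2).gain_det f1 y0 y2 y5
  obtain ⟨w1, w2⟩ := unalign ((hr 3).gain_ne_zero 1 (by decide))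
    ((hr 6).gain_ne_zero 1 (by decide)) (hr 3).gain_det g1 y1 y3 y6
  refine symbols_eq_zero hr (fun i hi => ?_) (fun i hi => ?_)
  · fin_cases i
    · exact absurd rfl hi
    · exact u1
    · exact u2
  · fin_cases i
    · exact absurd rfl hi
    · exact w1
    · exact w2

/-- The mirror image of `decode_second`: slots 5 and 6 exchange roles, and the heard and overheard
pairs are swapped. -/
theorem decode_third {H : ChannelSeq 9} (hr : ∀ t, SlotRegular (H t))
    {s₀ : Fin 9 → ℂ} {s₁ s₂ : Fin 4 → ℂ} (hy : ∀ t, slotOutput H s₀ s₁ s₂ t 2 = 0) : s₂ = 0 := by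
  have y0 := hy 0
  have y1 := hy 1
  have y2 := hy 2
  have y3 := hy 3
  have y4 := hy 4
  have y5 := hy 5
  have y6 := hy 6
  have y7 := hy 7
  have y8 := hy 8
  have triple : ∀ t, H t 2 ⬝ᵥ (H t 1 ⨯₃ e₀) ≠ 0 := fun t e => by
    refine (hr t).triple ?_
    rw [← neg_eq_zero, ← e]
    simp [dotProduct, cross_apply, Fin.sum_univ_three]
    ring
  rw [slotOutput_zero] at y0
  rw [slotOutput_one] at y1
  rw [slotOutput_two] at y2
  rw [slotOutput_three] at y3
  rw [slotOutput_four] at y4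
  rw [slotOutput_five] at y5
  rw [slotOutput_six] at y6
  rw [slotOutput_seven, dot_cross_self, dot_self_cross, zero_mul, zero_mul, zero_add,
    zero_add] at y7
  rw [slotOutput_eight, dot_self_cross, zero_mul, zero_add] at y8
  have f2 := (mul_eq_zero.1 y7).resolve_left (triple 7)
  have g2 := (mul_eq_zero.1 y8).resolve_left (triple 8)
  rw [f2, g2, mul_zero, mul_zero, add_zero, mul_zero, zero_add] at y5
  rw [f2, g2, add_zero, add_zero] at y4
  rw [y4, mul_zero, zero_add] at y6
  rw [fRow_dotProduct] at f2
  rw [gRow_dotProduct] at g2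
  have det : ∀ t, H t 2 0 * gain (H t) 1 - H t 1 0 * gain (H t) 2 ≠ 0 := fun t e =>
    (hr t).gain_det (by linear_combination -e)
  obtain ⟨u1, u2⟩ := unalign ((hr 2).gain_ne_zero 2 (by decide))
    ((hr 5).gain_ne_zero 2 (by decide)) (det 2) f2 (v := pairRow (H 0) 2 ⬝ᵥ s₁)
    (u := pairRow (H 0) 2 ⬝ᵥ s₂) (u' := pairRow (H 0) 1 ⬝ᵥ s₂)
    (by linear_combination y0) (by linear_combination y2) (by linear_combination y5)
  obtain ⟨w1, w2⟩ := unalign ((hr 3).gain_ne_zero 2 (by decide))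
    ((hr 6).gain_ne_zero 2 (by decide)) (det 3) g2 (v := pairRow' (H 1) 2 ⬝ᵥ s₁)
    (u := pairRow' (H 1) 2 ⬝ᵥ s₂) (u' := pairRow' (H 1) 1 ⬝ᵥ s₂)
    (by linear_combination y1) (by linear_combination y3) (by linear_combination y6)
  refine symbols_eq_zero hr (fun i hi => ?_) (fun i hi => ?_)
  · fin_cases i
    · exact absurd rfl hi
    · exact u2
    · exact u1
  · fin_cases i
    · exact absurd rfl hi
    · exact w2
    · exact w1

/-- The precoders of the scheme. -/
def precoders : (k : Fin 3) → ChannelSeq 9 → Fin 9 → Matrix (Fin 3) (Fin (![9, 4, 4] k)) ℂ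
  | 0 => precoder₀
  | 1 => precoder 1 2
  | 2 => precoder 2 1

theorem exists_decodable_alternatingCSIT {ν : Fin 3 → Measure (Fin 3 → ℂ)}
    [∀ i, IsProbabilityMeasure (ν i)] (hgen : ∀ i, IsGeneric (ν i)) :
    ∃ S : LinearScheme alternatingCSIT 9 ![9, 4, 4], S.Decodable ν := by
  refine exists_decodable_linearScheme ν precoders ?_ ?_ ?_
  · intro k t a l
    match k with
    | 0 => exact ((continuous_precoder₀ t).matrix_elem a l).measurable
    | 1 => exact ((continuous_precoder 1 2 t).matrix_elem a l).measurable
    | 2 => exact ((continuous_precoder 2 1 t).matrix_elem a l).measurable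
  · intro k
    match k with
    | 0 => exact isCausal_precoder₀
    | 1 => exact isCausal_precoder 1 2
    | 2 => exact isCausal_precoder 2 1
  · filter_upwards [ae_slotRegular hgen, ae_separatesSlots hgen] with H hr hs j s hy
    have hy' : ∀ t, slotOutput H (s 0) (s 1) (s 2) t j = 0 := fun t => by
      have := hy t
      rw [Fin.sum_univ_three] at this
      exact this
    match j with
    | 0 => exact decode_first hr hs hy'
    | 1 => exact decode_second hr hy'
    | 2 => exact decode_third hr hy'

/-! ### Block codes with large Hamming distance -/

/-- A point of the ball is free on the at most `D` coordinates where it differs from the centre and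
fixed elsewhere; at most `2 ^ card ι` coordinate sets are possible. -/
theorem card_hammingBall_le {ι A : Type*} [Fintype ι] [DecidableEq ι] [Fintype A] [DecidableEq A]
    [Nonempty A] (c : ι → A) (D : ℕ) :
    (Finset.univ.filter fun x : ι → A => hammingDist x c ≤ D).card ≤
      2 ^ Fintype.card ι * Fintype.card A ^ D := by
  let box : Finset ι → Finset (ι → A) := fun S =>
    Fintype.piFinset fun i => if i ∈ S then Finset.univ else {c i}
  have hbox : ∀ S, (box S).card = Fintype.card A ^ S.card := fun S => by
    simp only [box, Fintype.card_piFinset]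
    rw [← Finset.prod_subset (Finset.subset_univ S) (fun i _ hi => by simp [hi]),
      Finset.prod_congr rfl (fun i hi => by rw [if_pos hi]), Finset.prod_const, Finset.card_univ]
  have hsub : (Finset.univ.filter fun x : ι → A => hammingDist x c ≤ D) ⊆
      (Finset.univ.filter fun S : Finset ι => S.card ≤ D).biUnion box := by
    intro x hx
    rw [Finset.mem_filter] at hx
    rw [Finset.mem_biUnion]
    refine ⟨Finset.univ.filter fun i => x i ≠ c i, by simpa [hammingDist] using hx.2, ?_⟩
    simp only [box, Fintype.mem_piFinset]
    intro i
    by_cases h : x i = c i <;> simp [h]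
  calc _ ≤ _ := Finset.card_le_card hsub
    _ ≤ ∑ S ∈ Finset.univ.filter (fun S : Finset ι => S.card ≤ D), (box S).card :=
        Finset.card_biUnion_le
    _ ≤ ∑ S ∈ Finset.univ.filter (fun S : Finset ι => S.card ≤ D), Fintype.card A ^ D := by
        refine Finset.sum_le_sum fun S hS => ?_
        rw [hbox]
        exact Nat.pow_le_pow_right Fintype.card_pos (Finset.mem_filter.1 hS).2
    _ ≤ _ := by
        rw [Finset.sum_const, smul_eq_mul]
        refine Nat.mul_le_mul_right _ ((Finset.card_filter_le _ _).trans ?_)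
        simp

/-- The Gilbert–Varshamov bound, in a crude form. -/
theorem exists_code_hammingDist {ι A : Type*} [Fintype ι] [DecidableEq ι] [Fintype A]
    [DecidableEq A] [Nonempty A] (D : ℕ) :
    ∃ C : Finset (ι → A), (∀ x ∈ C, ∀ y ∈ C, x ≠ y → D < hammingDist x y) ∧
      Fintype.card A ^ Fintype.card ι ≤
        C.card * (2 ^ Fintype.card ι * Fintype.card A ^ D) := by
  -- A code of maximal size: its balls of radius `D` cover the space, since an uncovered point could
  -- be added.
  obtain ⟨C, hC, hmax⟩ := Finset.exists_max_image
    (Finset.univ.filter fun C : Finset (ι → A) => ∀ x ∈ C, ∀ y ∈ C, x ≠ y → D < hammingDist x y)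
    Finset.card ⟨∅, by simp⟩
  rw [Finset.mem_filter] at hC
  refine ⟨C, hC.2, ?_⟩
  have hcover : (Finset.univ : Finset (ι → A)) ⊆
      C.biUnion fun c => Finset.univ.filter fun x => hammingDist x c ≤ D := by
    intro x _
    by_contra hx
    simp only [Finset.mem_biUnion, Finset.mem_filter, Finset.mem_univ, true_and, not_exists,
      not_and, not_le] at hx
    have hxC : x ∉ C := fun h => by simpa using hx x h
    have := hmax (insert x C) (by
      simp only [Finset.mem_filter, Finset.mem_univ, true_and, Finset.mem_insert]
      rintro a (rfl | ha) b (rfl | hb) hab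
      · exact absurd rfl hab
      · exact hx b hb
      · rw [hammingDist_comm]; exact hx a ha
      · exact hC.2 a ha b hb hab)
    rw [Finset.card_insert_of_notMem hxC] at this
    omega
  calc Fintype.card A ^ Fintype.card ι = (Finset.univ : Finset (ι → A)).card := by simp
    _ ≤ _ := Finset.card_le_card hcover
    _ ≤ ∑ c ∈ C, _ := Finset.card_biUnion_le
    _ ≤ ∑ c ∈ C, 2 ^ Fintype.card ι * Fintype.card A ^ D :=
        Finset.sum_le_sum fun c _ => card_hammingBall_le c D
    _ = _ := by rw [Finset.sum_const, smul_eq_mul]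

/-! ### Independent blocks -/

/-- A Chernoff bound for the number of independent trials in which an event occurs. -/
theorem measure_pi_count_le {Ω : Type*} [MeasurableSpace Ω] (κ : Measure Ω)
    [IsProbabilityMeasure κ] {E : Set Ω} (hE : MeasurableSet E) (m : ℕ) (δ : ℝ)
    [DecidablePred (· ∈ E)] :
    Measure.pi (fun _ : Fin m => κ)
        {x | δ * m < ((Finset.univ.filter fun j => x j ∈ E).card : ℝ)} ≤
      ENNReal.ofReal (Real.exp (m * (2 * κ.real E - δ))) := by
  set f : Ω → ℝ := fun x => Real.exp (E.indicator 1 x) with hf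
  have hfE : f = fun x => 1 + E.indicator (fun _ => Real.exp 1 - 1) x := by
    ext x
    by_cases hx : x ∈ E <;> simp [hf, hx]
  have hfi : ∫ x, f x ∂κ = 1 + (Real.exp 1 - 1) * κ.real E := by
    rw [hfE, integral_add (integrable_const _) ((integrable_const _).indicator hE),
      integral_indicator_const _ hE]
    simp [mul_comm]
  -- The factor 2 in the bound comes from `exp 1 - 1 ≤ 2`.
  have hf2 : ∫ x, f x ∂κ ≤ Real.exp (2 * κ.real E) := by
    rw [hfi]
    have h1 := Real.add_one_le_exp (2 * κ.real E)
    have h2 := Real.exp_one_lt_d9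
    have h3 : 0 ≤ κ.real E := measureReal_nonneg
    nlinarith
  have hprod : ∀ x : Fin m → Ω, ∏ j, f (x j) =
      Real.exp ((Finset.univ.filter fun j => x j ∈ E).card : ℝ) := by
    intro x
    rw [← Real.exp_sum]
    congr 1
    rw [Finset.card_filter]
    push_cast
    exact Finset.sum_congr rfl fun j _ => by by_cases h : x j ∈ E <;> simp [h]
  have hint : ∫ x, ∏ j, f (x j) ∂(Measure.pi fun _ : Fin m => κ) = (∫ x, f x ∂κ) ^ m := by
    rw [integral_fintype_prod_eq_pow, Fintype.card_fin]
  have hfint : Integrable f κ := by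
    rw [hfE]; exact (integrable_const _).add ((integrable_const _).indicator hE)
  have hmarkov := mul_meas_ge_le_integral_of_nonneg (μ := Measure.pi fun _ : Fin m => κ)
    (f := fun x => ∏ j, f (x j)) (ae_of_all _ fun x => by simp only [hprod]; positivity)
    (Integrable.fintype_prod fun _ => hfint) (Real.exp (δ * m))
  rw [hint] at hmarkov
  have hreal : (Measure.pi fun _ : Fin m => κ).real
      {x | δ * m < ((Finset.univ.filter fun j => x j ∈ E).card : ℝ)} ≤
      Real.exp (m * (2 * κ.real E - δ)) := by
    refine (measureReal_mono (s₂ := {x | Real.exp (δ * m) ≤ ∏ j, f (x j)}) (fun x hx => ?_)).trans ?_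
    · simp only [Set.mem_ofPred_eq] at hx ⊢
      rw [hprod]
      exact Real.exp_le_exp.2 hx.le
    · have h0 : 0 ≤ ∫ x, f x ∂κ := integral_nonneg fun _ => (Real.exp_pos _).le
      have : Real.exp (m * (2 * κ.real E - δ)) =
          Real.exp (2 * κ.real E) ^ m / Real.exp (δ * m) := by
        rw [← Real.exp_nat_mul, ← Real.exp_sub]; ring_nf
      rw [this, le_div_iff₀ (Real.exp_pos _), mul_comm]
      exact hmarkov.trans (pow_le_pow_left₀ h0 hf2 m)
  rw [← ofReal_measureReal]
  exact ENNReal.ofReal_le_ofReal hreal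

theorem blockIndex_lt {n T : ℕ} (j : Fin (n / T)) (r : Fin T) : j * T + r < n := by
  have h1 := j.2
  have h2 := r.2
  calc (j : ℕ) * T + r < j * T + T := by omega
    _ = (j + 1) * T := by ring
    _ ≤ n / T * T := Nat.mul_le_mul_right _ h1
    _ ≤ n := Nat.div_mul_le_self n T

/-- The part of a sequence of length `n` in its `j`-th block of length `T`. -/
def block {X : Type*} {n T : ℕ} (x : Fin n → X) (j : Fin (n / T)) : Fin T → X :=
  fun r => x ⟨j * T + r, blockIndex_lt j r⟩

/-- The pairs (block, position) embed injectively into the times, so the selected coordinates are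
again independent with law `ρ`; currying the pair index gives the iterated product. -/
theorem measurePreserving_block {X : Type*} [MeasurableSpace X] (ρ : Measure X)
    [IsProbabilityMeasure ρ] (n T : ℕ) :
    MeasurePreserving (fun (x : Fin n → X) (j : Fin (n / T)) => (block x j : Fin T → X))
      (Measure.pi fun _ => ρ) (Measure.pi fun _ => Measure.pi fun _ => ρ) := by
  let e : Fin (n / T) × Fin T → Fin n := fun p => ⟨p.1 * T + p.2, blockIndex_lt p.1 p.2⟩
  have he : Function.Injective e := by
    rintro ⟨j, r⟩ ⟨j', r'⟩ h
    simp only [e, Fin.mk.injEq] at h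
    have hr := r.2
    have hr' := r'.2
    have hT : 0 < T := by omega
    have h1 : (j : ℕ) = j' := by
      have := congrArg (· / T) h
      simpa [Nat.add_div_of_dvd_right, Nat.mul_add_div, mul_comm _ T, Nat.div_eq_of_lt hr,
        Nat.div_eq_of_lt hr', Nat.mul_add_div hT] using this
    have h2 : (r : ℕ) = r' := by rw [h1] at h; omega
    ext <;> assumption
  have hind : iIndepFun (fun (i : Fin n) (x : Fin n → X) => x i) (Measure.pi fun _ => ρ) :=
    iIndepFun_pi (X := fun _ x => x) (fun _ => aemeasurable_id)
  have h1 := (iIndepFun_iff_map_fun_eq_pi_map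
    (fun p => (measurable_pi_apply (e p)).aemeasurable)).1 (hind.precomp he)
  have h2 : ∀ i : Fin n, (Measure.pi fun _ : Fin n => ρ).map (fun x => x i) = ρ := fun i =>
    (measurePreserving_eval (fun _ : Fin n => ρ) i).map_eq
  simp only [h2] at h1
  have h3 := Measure.infinitePi_map_curry (fun (_ : Fin (n / T)) (_ : Fin T) => ρ)
  simp only [Measure.infinitePi_eq_pi] at h3
  refine ⟨?_, ?_⟩
  · exact measurable_pi_lambda _ fun j => measurable_pi_lambda _ fun r => measurable_pi_apply _
  · have hm : Measurable fun (x : Fin n → X) p => x (e p) :=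
      measurable_pi_lambda _ fun p => measurable_pi_apply _
    rw [← h3, ← h1, Measure.map_map (MeasurableEquiv.measurable _) hm]
    rfl

theorem measurePreserving_block_prod {X Y : Type*} [MeasurableSpace X] [MeasurableSpace Y]
    (ρ : Measure X) (τ : Measure Y) [IsProbabilityMeasure ρ] [IsProbabilityMeasure τ] (n T : ℕ) :
    MeasurePreserving
      (fun (ω : (Fin n → X) × (Fin n → Y)) (j : Fin (n / T)) =>
        ((block ω.1 j, block ω.2 j) : (Fin T → X) × (Fin T → Y)))
      ((Measure.pi fun _ => ρ).prod (Measure.pi fun _ => τ))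
      (Measure.pi fun _ => (Measure.pi fun _ => ρ).prod (Measure.pi fun _ => τ)) := by
  have h1 := (measurePreserving_arrowProdEquivProdArrow X Y (Fin n) (fun _ => ρ) (fun _ => τ)).symm
  have h2 := measurePreserving_block (ρ.prod τ) n T
  have h3 := measurePreserving_pi (fun _ : Fin (n / T) => Measure.pi fun _ : Fin T => ρ.prod τ)
    (fun _ => (Measure.pi fun _ => ρ).prod (Measure.pi fun _ => τ))
    (fun _ => measurePreserving_arrowProdEquivProdArrow X Y (Fin T) (fun _ => ρ) (fun _ => τ))
  exact (h3.comp h2).comp h1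

/-! ### Measurable selection from finitely many options -/

/-- Choosing the first index that works is measurable. This supplies the decoder. -/
theorem exists_measurable_selection {Ω : Type*} [MeasurableSpace Ω] {M : ℕ} (hM : 0 < M)
    (B : Fin M → Set Ω) (hB : ∀ a, MeasurableSet (B a)) :
    ∃ g : Ω → Fin M, Measurable g ∧ ∀ ω a, ω ∈ B a → ω ∈ B (g ω) := by
  classical
  induction M with
  | zero => omega
  | succ M ih =>
    rcases Nat.eq_zero_or_pos M with rfl | hM'
    · exact ⟨fun _ => 0, measurable_const, fun ω a h => by
        rwa [Fin.fin_one_eq_zero a] at h⟩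
    · obtain ⟨g, hg, hgB⟩ := ih hM' (fun a => B a.succ) (fun a => hB _)
      refine ⟨(B 0).piecewise (fun _ => 0) (fun ω => (g ω).succ),
        measurable_const.piecewise (hB 0) ((measurable_of_finite Fin.succ).comp hg), fun ω a h => ?_⟩
      by_cases h0 : ω ∈ B 0
      · rwa [Set.piecewise_eq_of_mem _ _ _ h0]
      · rw [Set.piecewise_eq_of_notMem _ _ _ h0]
        induction a using Fin.cases with
        | zero => exact absurd h h0
        | succ a => exact hgB ω a h

/-! ### Modulation over one period of a linear scheme -/

instance isProbabilityMeasure_complexGaussian (v : ℝ≥0) :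
    IsProbabilityMeasure (complexGaussian v) := by
  refine Measure.isProbabilityMeasure_map (Measurable.aemeasurable ?_)
  have : (fun p : ℝ × ℝ => (⟨p.1, p.2⟩ : ℂ)) = fun p => (p.1 : ℂ) + p.2 * Complex.I := by
    ext p; exact Complex.mk_eq_add_mul_I _ _
  rw [this]
  fun_prop

instance isProbabilityMeasure_noiseLaw (N : Fin 3 → ℝ≥0) (n : ℕ) :
    IsProbabilityMeasure (noiseLaw N n) := by
  unfold noiseLaw; infer_instance

instance isProbabilityMeasure_channelLaw (ν : Fin 3 → Measure (Fin 3 → ℂ))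
    [∀ i, IsProbabilityMeasure (ν i)] (n : ℕ) : IsProbabilityMeasure (channelLaw ν n) := by
  unfold channelLaw; infer_instance

/-- The Gaussian integer with the given coordinates. -/
def gaussInt (a : ℤ × ℤ) : ℂ := a.1 + a.2 * Complex.I

theorem gaussInt_sub (a b : ℤ × ℤ) : gaussInt (a - b) = gaussInt a - gaussInt b := by
  simp [gaussInt]; ring

theorem one_le_norm_gaussInt {a : ℤ × ℤ} (ha : a ≠ 0) : 1 ≤ ‖gaussInt a‖ := by
  have hre : (gaussInt a).re = a.1 := by simp [gaussInt]
  have him : (gaussInt a).im = a.2 := by simp [gaussInt]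
  by_cases h : a.1 = 0
  · have h2 : a.2 ≠ 0 := fun h2 => ha (Prod.ext h h2)
    have := Complex.abs_im_le_norm (gaussInt a)
    rw [him] at this
    exact le_trans (by exact_mod_cast Int.one_le_abs h2) this
  · have := Complex.abs_re_le_norm (gaussInt a)
    rw [hre] at this
    exact le_trans (by exact_mod_cast Int.one_le_abs h) this

/-- The alphabet of one receiver in one period: a point of an `L × L` grid for each symbol. -/
abbrev Letter (b : ℕ) (L : ℕ) : Type := Fin b → Fin L × Fin L

/-- The integer coordinates of a grid point. -/
def gridInt {L : ℕ} (a : Fin L × Fin L) : ℤ × ℤ := ((a.1 : ℕ), (a.2 : ℕ))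

theorem gridInt_injective {L : ℕ} : Function.Injective (gridInt (L := L)) := by
  rintro ⟨a, b⟩ ⟨c, d⟩ h
  simp only [gridInt, Prod.mk.injEq, Nat.cast_inj] at h
  exact Prod.ext (Fin.ext h.1) (Fin.ext h.2)

/-- The data symbols of all receivers for given letters, on a grid of spacing `K`. -/
def modulate {b : Fin 3 → ℕ} {L : ℕ} (K : ℝ) (σ : (k : Fin 3) → Letter (b k) L) :
    (k : Fin 3) → Fin (b k) → ℂ :=
  fun k l => K * gaussInt (gridInt (σ k l))

theorem norm_modulate_le {b : Fin 3 → ℕ} {L : ℕ} {K : ℝ} (hK : 0 ≤ K)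
    (σ : (k : Fin 3) → Letter (b k) L) (k : Fin 3) (l : Fin (b k)) :
    ‖modulate K σ k l‖ ≤ 2 * K * L := by
  have h3 : ‖gaussInt (gridInt (σ k l))‖ ≤ L + L := by
    refine (norm_add_le _ _).trans (add_le_add ?_ ?_)
    · simp [gridInt]
    · simp [gridInt]
  rw [modulate, norm_mul, Complex.norm_real, Real.norm_of_nonneg hK]
  nlinarith

namespace LinearScheme

variable {csit : ℕ → Fin 3 → CSIT} {T : ℕ} {b : Fin 3 → ℕ} (S : LinearScheme csit T b)

/-- The noise-free output of receiver `j`. -/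
def output (H : ChannelSeq T) (s : (k : Fin 3) → Fin (b k) → ℂ) (j : Fin 3) : Fin T → ℂ :=
  fun t => H t j ⬝ᵥ S.signal s H t

theorem output_sub (H : ChannelSeq T) (s s' : (k : Fin 3) → Fin (b k) → ℂ) (j : Fin 3) :
    S.output H (s - s') j = S.output H s j - S.output H s' j := by
  ext t
  simp [output, signal, Matrix.mulVec_sub, dotProduct_sub]

theorem output_smul (H : ChannelSeq T) (c : ℂ) (s : (k : Fin 3) → Fin (b k) → ℂ) (j : Fin 3) :
    S.output H (c • s) j = c • S.output H s j := by
  ext t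
  simp [output, signal, Matrix.mulVec_smul, ← Finset.smul_sum]

theorem measurable_signal (s : (k : Fin 3) → Fin (b k) → ℂ) :
    Measurable fun H => S.signal s H := by
  refine measurable_pi_lambda _ fun t => measurable_pi_lambda _ fun a => ?_
  simp only [signal, Finset.sum_apply, Matrix.mulVec, dotProduct]
  exact Finset.measurable_fun_sum _ fun k _ => Finset.measurable_fun_sum _ fun l _ =>
    (S.measurable_V k t a l).mul_const _

theorem measurable_output (s : (k : Fin 3) → Fin (b k) → ℂ) (j : Fin 3) :
    Measurable fun H => S.output H s j := by
  refine measurable_pi_lambda _ fun t => ?_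
  have := S.measurable_signal s
  simp only [output, dotProduct]
  fun_prop

theorem exists_norm_signal_le : ∃ C : ℝ, 0 < C ∧
    ∀ (s : (k : Fin 3) → Fin (b k) → ℂ) (A : ℝ), (∀ k l, ‖s k l‖ ≤ A) → 0 ≤ A →
      ∀ H t a, ‖S.signal s H t a‖ ≤ C * A := by
  obtain ⟨C, hC⟩ := S.bounded_V
  refine ⟨(∑ k, b k) * |C| + 1, by positivity, fun s A hs hA H t a => ?_⟩
  simp only [signal, Finset.sum_apply, Matrix.mulVec, dotProduct]
  calc ‖∑ k, ∑ l, S.V k H t a l * s k l‖ ≤ ∑ k, ∑ l : Fin (b k), |C| * A := by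
        refine (norm_sum_le _ _).trans (Finset.sum_le_sum fun k _ => ?_)
        refine (norm_sum_le _ _).trans (Finset.sum_le_sum fun l _ => ?_)
        rw [norm_mul]
        exact mul_le_mul ((hC k H t a l).trans (le_abs_self C)) (hs k l) (norm_nonneg _)
          (abs_nonneg C)
    _ = (∑ k, (b k : ℝ)) * |C| * A := by
        simp [Finset.sum_mul, mul_assoc]
    _ ≤ _ := by
        push_cast
        nlinarith

/-- The event that the noise at receiver `j` may confuse letters on a grid of spacing `K`. -/
def badSet (j : Fin 3) (K : ℝ) : Set (ChannelSeq T × NoiseSeq T) :=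
  {ω | ∃ w : (k : Fin 3) → Fin (b k) → ℤ × ℤ, w j ≠ 0 ∧
    K * ‖S.output ω.1 (fun k l => gaussInt (w k l)) j‖ ≤ 2 * ‖fun t => ω.2 t j‖}

/-- The integer vectors `w` are countable, so this is a countable union. -/
theorem measurableSet_badSet (j : Fin 3) (K : ℝ) : MeasurableSet (S.badSet j K) := by
  refine measurableSet_setOfPred.2 (Measurable.exists fun w => measurable_const.and
    (measurableSet_setOfPred.1 (measurableSet_le ?_ ?_)))
  · exact ((S.measurable_output _ j).comp measurable_fst).norm.const_mul K
  · refine (Measurable.norm ?_).const_mul 2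
    fun_prop

/-- A decoding matrix expands nonzero integer differences to norm at least 1, so almost every
outcome leaves the bad event once `K` exceeds twice the matrix norm times the noise. All integer
differences are allowed, so the bound does not depend on the grid size. -/
theorem tendsto_measure_badSet {ν : Fin 3 → Measure (Fin 3 → ℂ)}
    [∀ i, IsProbabilityMeasure (ν i)] (hS : S.Decodable ν) (N : Fin 3 → ℝ≥0) (j : Fin 3) :
    Tendsto (fun K : ℝ => ((channelLaw ν T).prod (noiseLaw N T)).real (S.badSet j K)) atTop
      (𝓝 0) := by
  have hae : ∀ᵐ ω ∂((channelLaw ν T).prod (noiseLaw N T)),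
      ∀ᶠ K : ℝ in atTop, ω ∈ S.badSet j K ↔ ω ∈ (∅ : Set (ChannelSeq T × NoiseSeq T)) := by
    have := (Measure.quasiMeasurePreserving_fst (μ := channelLaw ν T) (ν := noiseLaw N T)).ae hS
    filter_upwards [this] with ω hω
    obtain ⟨D, hD⟩ := hω j
    set z : ℝ := ‖fun t => ω.2 t j‖
    let F : (Fin T → ℂ) →L[ℂ] (Fin (b j) → ℂ) := LinearMap.toContinuousLinearMap (Matrix.mulVecLin D)
    filter_upwards [eventually_gt_atTop (2 * ‖F‖ * z), eventually_gt_atTop 0] with K hK hK0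
    simp only [Set.mem_empty_iff_false, iff_false]
    rintro ⟨w, hw, hle⟩
    obtain ⟨l, hl⟩ := Function.ne_iff.1 hw
    have h1 : 1 ≤ ‖F (S.output ω.1 (fun k l => gaussInt (w k l)) j)‖ := by
      have e : F (S.output ω.1 (fun k l => gaussInt (w k l)) j) = fun l => gaussInt (w j l) :=
        hD _
      rw [e]
      exact (one_le_norm_gaussInt hl).trans (norm_le_pi_norm (fun l => gaussInt (w j l)) l)
    have h2 := F.le_opNorm (S.output ω.1 (fun k l => gaussInt (w k l)) j)
    have h3 : K * 1 ≤ ‖F‖ * (2 * z) :=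
      calc K * 1 ≤ K * (‖F‖ * ‖S.output ω.1 (fun k l => gaussInt (w k l)) j‖) :=
            mul_le_mul_of_nonneg_left (h1.trans h2) hK0.le
        _ = ‖F‖ * (K * ‖S.output ω.1 (fun k l => gaussInt (w k l)) j‖) := by ring
        _ ≤ _ := mul_le_mul_of_nonneg_left hle (norm_nonneg _)
    linarith
  have := tendsto_measure_of_ae_tendsto_indicator_of_isFiniteMeasure atTop
    (μ := (channelLaw ν T).prod (noiseLaw N T)) MeasurableSet.empty
    (fun K => S.measurableSet_badSet j K) hae
  rw [measure_empty] at this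
  exact (ENNReal.tendsto_toReal ENNReal.zero_ne_top).comp this

/-- The letter `a` of receiver `j` occurs in a choice of letters that explains the output best. -/
def Compatible (j : Fin 3) {L : ℕ} (K : ℝ) (H : ChannelSeq T) (y : Fin T → ℂ)
    (a : Letter (b j) L) : Prop :=
  ∃ σ : (k : Fin 3) → Letter (b k) L, σ j = a ∧ ∀ σ' : (k : Fin 3) → Letter (b k) L,
    ‖y - S.output H (modulate K σ) j‖ ≤ ‖y - S.output H (modulate K σ') j‖

theorem measurableSet_compatible {Ω : Type*} [MeasurableSpace Ω] (j : Fin 3) {L : ℕ} (K : ℝ)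
    (a : Letter (b j) L) {H : Ω → ChannelSeq T} {y : Ω → Fin T → ℂ} (hH : Measurable H)
    (hy : Measurable y) : MeasurableSet {ω | S.Compatible j K (H ω) (y ω) a} := by
  exact measurableSet_setOfPred.2 (Measurable.exists fun σ => measurable_const.and
    (Measurable.forall fun σ' => measurableSet_setOfPred.1 (measurableSet_le
      (hy.sub ((S.measurable_output _ j).comp hH)).norm
      (hy.sub ((S.measurable_output _ j).comp hH)).norm)))

/-- If another choice of letters explains the output at least as well as the true one, the two
noise-free outputs differ by at most twice the noise. Off the bad event this forces equal letters
for receiver `j`, though not for the others. -/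
theorem compatible_iff {j : Fin 3} {L : ℕ} {K : ℝ} (hK : 0 ≤ K) {H : ChannelSeq T}
    {Z : NoiseSeq T} (hgood : (H, Z) ∉ S.badSet j K) (σ : (k : Fin 3) → Letter (b k) L)
    (a : Letter (b j) L) :
    S.Compatible j K H (S.output H (modulate K σ) j + fun t => Z t j) a ↔ a = σ j := by
  set y := S.output H (modulate K σ) j + fun t => Z t j with hy
  have key : ∀ τ : (k : Fin 3) → Letter (b k) L,
      (∀ σ' : (k : Fin 3) → Letter (b k) L,
        ‖y - S.output H (modulate K τ) j‖ ≤ ‖y - S.output H (modulate K σ') j‖) → τ j = σ j := by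
    intro τ hτ
    by_contra hne
    refine hgood ⟨fun k l => gridInt (σ k l) - gridInt (τ k l), fun h => hne ?_, ?_⟩
    · funext l
      exact (gridInt_injective (sub_eq_zero.1 (congrFun h l))).symm
    · have e : modulate K σ - modulate K τ =
          (K : ℂ) • fun k l => gaussInt (gridInt (σ k l) - gridInt (τ k l)) := by
        ext k l
        simp [modulate, gaussInt_sub, mul_sub]
      have h1 : K * ‖S.output H (fun k l => gaussInt (gridInt (σ k l) - gridInt (τ k l))) j‖ =
          ‖S.output H (modulate K σ) j - S.output H (modulate K τ) j‖ := by
        rw [← output_sub, e, output_smul, norm_smul, Complex.norm_real, Real.norm_of_nonneg hK]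
      have h2 : y - S.output H (modulate K σ) j = fun t => Z t j := by rw [hy, add_sub_cancel_left]
      have h3 := hτ σ
      rw [h2] at h3
      have h4 : S.output H (modulate K σ) j - S.output H (modulate K τ) j =
          (y - S.output H (modulate K τ) j) - fun t => Z t j := by rw [← h2]; abel
      change K * _ ≤ _
      rw [h1, h4]
      refine (norm_sub_le _ _).trans ?_
      change _ ≤ 2 * ‖fun t => Z t j‖
      linarith
  constructor
  · rintro ⟨τ, rfl, hτ⟩
    exact key τ hτ
  · rintro rfl
    obtain ⟨τ, -, hτ⟩ := Finset.exists_min_image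
      (Finset.univ : Finset ((k : Fin 3) → Letter (b k) L))
      (fun τ => ‖y - S.output H (modulate K τ) j‖) ⟨σ, Finset.mem_univ _⟩
    exact ⟨τ, key τ fun σ' => hτ σ' (Finset.mem_univ _), fun σ' => hτ σ' (Finset.mem_univ _)⟩

end LinearScheme

/-! ### Block codes from a linear scheme -/

namespace LinearScheme

variable {csit : ℕ → Fin 3 → CSIT} {T : ℕ} {b : Fin 3 → ℕ} (S : LinearScheme csit T b)

theorem signal_congr (s : (k : Fin 3) → Fin (b k) → ℂ) {H H' : ChannelSeq T} {t : Fin T}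
    (h : ∀ (r : Fin T) (i : Fin 3), Known csit t r i → H r i = H' r i) :
    S.signal s H t = S.signal s H' t := by
  simp only [signal, fun k => S.causal_V k t H H' h]

/-- Use the scheme in each block of length `T`, for letters `σ j` in block `j`; at the remaining
times send nothing. -/
def blockSignal (hT : 0 < T) {L n : ℕ} (K : ℝ) (σ : Fin (n / T) → (k : Fin 3) → Letter (b k) L)
    (H : ChannelSeq n) (t : Fin n) : Fin 3 → ℂ :=
  if h : t / T < n / T then
    S.signal (modulate K (σ ⟨t / T, h⟩)) (block H ⟨t / T, h⟩) ⟨t % T, Nat.mod_lt _ hT⟩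
  else 0

variable (hT : 0 < T) {L n : ℕ} (K : ℝ) (σ : Fin (n / T) → (k : Fin 3) → Letter (b k) L)

theorem block_blockSignal (H : ChannelSeq n) (j : Fin (n / T)) (r : Fin T) :
    block (S.blockSignal hT K σ H) j r = S.signal (modulate K (σ j)) (block H j) r := by
  have h1 : (j * T + r : ℕ) / T = j := by
    rw [mul_comm, Nat.mul_add_div hT, Nat.div_eq_of_lt r.2, add_zero]
  have h2 : (j * T + r : ℕ) % T = r := by
    rw [mul_comm, Nat.mul_add_mod, Nat.mod_eq_of_lt r.2]
  simp only [block, blockSignal, h1, h2, Fin.eta, j.2, dite_true]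

theorem measurable_blockSignal : Measurable (S.blockSignal hT K σ) := by
  refine measurable_pi_lambda _ fun t => ?_
  unfold blockSignal
  split_ifs with h
  · refine (measurable_pi_apply _).comp ((S.measurable_signal _).comp ?_)
    exact measurable_pi_lambda _ fun r => measurable_pi_apply _
  · exact measurable_const

/-- Periodicity of the CSIT identifies what is known inside a block with what is known in the first
period, so only knowledge from the current block is used. -/
theorem isCausal_blockSignal (hper : ∀ t, csit (t + T) = csit t) :
    IsCausal csit (S.blockSignal hT K σ) := by
  intro t H H' h
  have hper' : ∀ j s, csit (j * T + s) = csit s := by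
    intro j s
    induction j with
    | zero => rw [zero_mul, zero_add]
    | succ j ih => rw [← ih, ← hper (j * T + s)]; congr 1; ring
  unfold blockSignal
  split_ifs with ht
  · refine S.signal_congr _ fun r i hr => h _ i ?_
    have e : (t : ℕ) = t / T * T + t % T := by rw [mul_comm]; exact (Nat.div_add_mod _ _).symm
    simp only [Known, hper'] at hr ⊢
    rcases hr with ⟨h1, h2⟩ | ⟨h1, h2⟩
    · exact Or.inl ⟨h1, by omega⟩
    · exact Or.inr ⟨h1, by omega⟩
  · rfl

theorem sum_enorm_blockSignal_le {C : ℝ} (hC : 0 < C)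
    (hbound : ∀ (s : (k : Fin 3) → Fin (b k) → ℂ) (A : ℝ), (∀ k l, ‖s k l‖ ≤ A) → 0 ≤ A →
      ∀ H t a, ‖S.signal s H t a‖ ≤ C * A)
    (hK : 0 ≤ K) {P : ℝ} (hP : 3 * (C * (2 * K * L)) ^ 2 ≤ P) (H : ChannelSeq n) (t : Fin n) :
    ∑ a, ‖S.blockSignal hT K σ H t a‖ₑ ^ 2 ≤ ENNReal.ofReal P := by
  have h0 : ∀ a, ‖S.blockSignal hT K σ H t a‖ ≤ C * (2 * K * L) := by
    intro a
    unfold blockSignal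
    split_ifs with h
    · exact hbound _ _ (norm_modulate_le hK _) (by positivity) _ _ _
    · simp only [Pi.zero_apply, norm_zero]; positivity
  calc ∑ a, ‖S.blockSignal hT K σ H t a‖ₑ ^ 2
      ≤ ∑ _a : Fin 3, ENNReal.ofReal ((C * (2 * K * L)) ^ 2) := by
        refine Finset.sum_le_sum fun a _ => ?_
        rw [← ofReal_norm, ← ENNReal.ofReal_pow (norm_nonneg _)]
        exact ENNReal.ofReal_le_ofReal (pow_le_pow_left₀ (norm_nonneg _) (h0 a) 2)
    _ = ENNReal.ofReal (3 * (C * (2 * K * L)) ^ 2) := by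
        rw [← ENNReal.ofReal_sum_of_nonneg fun _ _ => by positivity]
        congr 1
        simp
    _ ≤ _ := ENNReal.ofReal_le_ofReal hP

end LinearScheme

theorem card_messages (M : Fin 3 → ℕ) :
    ((Finset.univ : Finset ((i : Fin 3) → Fin (M i))).card : ℝ≥0∞) = ∏ i, (M i : ℝ≥0∞) := by
  simp [Fintype.card_pi]

theorem Code.powerConstraint_of_forall_le {csit : ℕ → Fin 3 → CSIT} {n : ℕ} {M : Fin 3 → ℕ}
    (c : Code csit n M) (ν : Fin 3 → Measure (Fin 3 → ℂ)) [∀ i, IsProbabilityMeasure (ν i)] {P : ℝ}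
    (h : ∀ m H t, ∑ a, ‖c.enc m H t a‖ₑ ^ 2 ≤ ENNReal.ofReal P) : c.PowerConstraint ν P := by
  intro t
  refine ENNReal.div_le_of_le_mul ?_
  calc ∑ m, ∫⁻ H, ∑ a, ‖c.enc m H t a‖ₑ ^ 2 ∂(channelLaw ν n)
      ≤ ∑ _m : (i : Fin 3) → Fin (M i), ENNReal.ofReal P := by
        refine Finset.sum_le_sum fun m _ => ?_
        refine (lintegral_mono fun H => h m H t).trans ?_
        rw [lintegral_const, measure_univ, mul_one]
    _ = _ := by rw [Finset.sum_const, nsmul_eq_mul, card_messages, mul_comm]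

theorem Code.errorProb_le_of_forall_le {csit : ℕ → Fin 3 → CSIT} {n : ℕ} {M : Fin 3 → ℕ}
    (c : Code csit n M) (ν : Fin 3 → Measure (Fin 3 → ℂ)) (N : Fin 3 → ℝ≥0) (i : Fin 3) {ε : ℝ≥0∞}
    (h : ∀ m, ((channelLaw ν n).prod (noiseLaw N n))
      {ω | c.dec i ω.1 (c.output m ω.1 ω.2 i) ≠ m i} ≤ ε) : c.errorProb ν N i ≤ ε := by
  refine ENNReal.div_le_of_le_mul ((Finset.sum_le_sum fun m _ => h m).trans_eq ?_)
  rw [Finset.sum_const, nsmul_eq_mul, card_messages, mul_comm]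

/-- The code that sends nothing. -/
theorem exists_silent_code (csit : ℕ → Fin 3 → CSIT) (n : ℕ) {M : Fin 3 → ℕ} (hM : ∀ i, 0 < M i)
    (ν : Fin 3 → Measure (Fin 3 → ℂ)) [∀ i, IsProbabilityMeasure (ν i)] (P : ℝ) :
    ∃ c : Code csit n M, c.PowerConstraint ν P :=
  ⟨⟨fun _ _ _ => 0, fun _ => measurable_const, fun _ _ _ _ _ => rfl, fun i _ _ => ⟨0, hM i⟩,
    fun _ => measurable_const⟩, Code.powerConstraint_of_forall_le _ ν fun _ _ _ => by simp⟩

theorem measurableSet_card_filter_le {Ω : Type*} [MeasurableSpace Ω] {m : ℕ}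
    {p : Fin m → Ω → Prop} [∀ j, DecidablePred (p j)] (hp : ∀ j, MeasurableSet {ω | p j ω}) (D : ℕ) :
    MeasurableSet {ω | (Finset.univ.filter fun j => p j ω).card ≤ D} := by
  simp only [Finset.card_filter]
  exact measurableSet_le (Finset.measurable_fun_sum _ fun j _ =>
    Measurable.ite (hp j) measurable_const measurable_const) measurable_const

theorem measurable_block {X : Type*} [MeasurableSpace X] {n T : ℕ} (j : Fin (n / T)) :
    Measurable fun x : Fin n → X => (block x j : Fin T → X) :=
  measurable_pi_lambda _ fun _ => measurable_pi_apply _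

/-! ### Outer decoding across blocks -/

section
variable {csit : ℕ → Fin 3 → CSIT} {T : ℕ} {b : Fin 3 → ℕ}
  (S : LinearScheme csit T b) (hT : 0 < T) {L n : ℕ} {M : Fin 3 → ℕ}
  (cw : (k : Fin 3) → Fin (M k) → Fin (n / T) → Letter (b k) L)

open Classical in
/-- The outputs at receiver `i` for which all but at most `D` blocks are compatible with
message `m`. -/
def explainedBy (K : ℝ) (D : ℕ) (i : Fin 3) (m : Fin (M i)) :
    Set (ChannelSeq n × (Fin n → ℂ)) :=
  {ω | (Finset.univ.filter fun j : Fin (n / T) =>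
    ¬ S.Compatible i K (block ω.1 j) (block ω.2 j) (cw i m j)).card ≤ D}

theorem measurableSet_explainedBy (K : ℝ) (D : ℕ) (i : Fin 3) (m : Fin (M i)) :
    MeasurableSet (explainedBy S cw K D i m) := by
  classical
  refine measurableSet_card_filter_le (p := fun j (ω : ChannelSeq n × (Fin n → ℂ)) =>
    ¬ S.Compatible i K (block ω.1 j) (block ω.2 j) (cw i m j)) (fun j => MeasurableSet.compl ?_) D
  exact S.measurableSet_compatible i K (cw i m j) ((measurable_block j).comp measurable_fst)
    ((measurable_block j).comp measurable_snd)

open Classical in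
/-- The blocks in which the noise at receiver `i` may confuse letters. -/
def badBlocks (K : ℝ) (i : Fin 3) (H : ChannelSeq n) (Z : NoiseSeq n) : Finset (Fin (n / T)) :=
  Finset.univ.filter fun j =>
    ((block H j, block Z j) : ChannelSeq T × NoiseSeq T) ∈ S.badSet i K

/-- The outputs of receiver `i` when the scheme is used in blocks for the messages `m`. -/
def blockOutput (K : ℝ) (m : (k : Fin 3) → Fin (M k)) (H : ChannelSeq n) (Z : NoiseSeq n)
    (i : Fin 3) : Fin n → ℂ :=
  fun t => H t i ⬝ᵥ S.blockSignal hT K (fun j k => cw k (m k) j) H t + Z t i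

theorem block_blockOutput (K : ℝ) (m : (k : Fin 3) → Fin (M k)) (H : ChannelSeq n)
    (Z : NoiseSeq n) (i : Fin 3) (j : Fin (n / T)) :
    block (blockOutput S hT cw K m H Z i) j =
      S.output (block H j) (modulate K fun k => cw k (m k) j) i +
        fun r => (block Z j : NoiseSeq T) r i := by
  ext r
  have := S.block_blockSignal hT K (fun j k => cw k (m k) j) H j r
  simp only [block] at this
  simp only [block, blockOutput, LinearScheme.output, Pi.add_apply, this]

theorem compatible_iff_of_notMem_badBlocks {K : ℝ} (hK : 0 ≤ K) (m : (k : Fin 3) → Fin (M k))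
    {H : ChannelSeq n} {Z : NoiseSeq n} {i : Fin 3} {j : Fin (n / T)}
    (hj : j ∉ badBlocks S K i H Z) (a : Letter (b i) L) :
    S.Compatible i K (block H j) (block (blockOutput S hT cw K m H Z i) j) a ↔
      a = cw i (m i) j := by
  classical
  rw [block_blockOutput]
  exact S.compatible_iff hK (fun h => hj (Finset.mem_filter.2 ⟨Finset.mem_univ _, h⟩))
    (fun k => cw k (m k) j) a

theorem mem_explainedBy_self {K : ℝ} (hK : 0 ≤ K) {D : ℕ} (m : (k : Fin 3) → Fin (M k))
    {H : ChannelSeq n} {Z : NoiseSeq n} {i : Fin 3} (hbad : (badBlocks S K i H Z).card ≤ D) :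
    (H, blockOutput S hT cw K m H Z i) ∈ explainedBy S cw K D i (m i) := by
  classical
  refine (Finset.card_le_card fun j hj => ?_).trans hbad
  by_contra hjb
  exact (Finset.mem_filter.1 hj).2
    ((compatible_iff_of_notMem_badBlocks S hT cw hK m hjb _).2 rfl)

/-- Outside the at most `D` bad blocks only the true letter is compatible, and `x` is incompatible
in at most `D` blocks. -/
theorem hammingDist_le_of_mem_explainedBy {K : ℝ} (hK : 0 ≤ K) {D : ℕ}
    (m : (k : Fin 3) → Fin (M k)) {H : ChannelSeq n} {Z : NoiseSeq n} {i : Fin 3}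
    (hbad : (badBlocks S K i H Z).card ≤ D) {x : Fin (M i)}
    (hx : (H, blockOutput S hT cw K m H Z i) ∈ explainedBy S cw K D i x) :
    hammingDist (cw i x) (cw i (m i)) ≤ 2 * D := by
  classical
  have hsub : (Finset.univ.filter fun j => cw i x j ≠ cw i (m i) j) ⊆
      (Finset.univ.filter fun j : Fin (n / T) => ¬ S.Compatible i K (block H j)
        (block (blockOutput S hT cw K m H Z i) j) (cw i x j)) ∪ badBlocks S K i H Z := by
    intro j hj
    rw [Finset.mem_union]
    by_contra hcon
    push Not at hcon
    obtain ⟨h1, h2⟩ := hcon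
    rw [Finset.mem_filter, not_and, not_not] at h1
    exact (Finset.mem_filter.1 hj).2
      ((compatible_iff_of_notMem_badBlocks S hT cw hK m h2 _).1 (h1 (Finset.mem_univ _)))
  rw [two_mul]
  exact (Finset.card_le_card hsub).trans
    ((Finset.card_union_le _ _).trans (add_le_add hx hbad))

theorem exists_code_of_codewords (hT : 0 < T) (hper : ∀ t, csit (t + T) = csit t)
    (ν : Fin 3 → Measure (Fin 3 → ℂ)) [∀ i, IsProbabilityMeasure (ν i)] (N : Fin 3 → ℝ≥0)
    {C : ℝ} (hC : 0 < C)
    (hbound : ∀ (s : (k : Fin 3) → Fin (b k) → ℂ) (A : ℝ), (∀ k l, ‖s k l‖ ≤ A) → 0 ≤ A →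
      ∀ H t a, ‖S.signal s H t a‖ ≤ C * A)
    {K : ℝ} (hK : 0 ≤ K) {P : ℝ} (hP : 3 * (C * (2 * K * L)) ^ 2 ≤ P)
    (hM : ∀ i, 0 < M i) (D : ℕ)
    (hcw : ∀ k x y, x ≠ y → 2 * D < hammingDist (cw k x) (cw k y)) :
    ∃ c : Code csit n M, c.PowerConstraint ν P ∧ ∀ i, c.errorProb ν N i ≤
      ((channelLaw ν n).prod (noiseLaw N n)) {ω | D < (badBlocks S K i ω.1 ω.2).card} := by
  have hsel : ∀ i, ∃ g : ChannelSeq n × (Fin n → ℂ) → Fin (M i), Measurable g ∧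
      ∀ ω a, ω ∈ explainedBy S cw K D i a → ω ∈ explainedBy S cw K D i (g ω) := fun i =>
    exists_measurable_selection (hM i) _ (measurableSet_explainedBy S cw K D i)
  choose g hg hgB using hsel
  have hdec : ∀ i, Measurable (Function.uncurry fun H y => g i (H, y)) := fun i => hg i
  have hpow : ∀ (m : (i : Fin 3) → Fin (M i)) (H : ChannelSeq n) (t : Fin n),
      ∑ a, ‖S.blockSignal hT K (fun j k => cw k (m k) j) H t a‖ₑ ^ 2 ≤ ENNReal.ofReal P :=
    fun m H t => S.sum_enorm_blockSignal_le hT K (fun j k => cw k (m k) j) hC hbound hK hP H t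
  let c : Code csit n M := ⟨fun m => S.blockSignal hT K fun j k => cw k (m k) j,
    fun m => S.measurable_blockSignal hT K _, fun m => S.isCausal_blockSignal hT K _ hper,
    fun i H y => g i (H, y), hdec⟩
  refine ⟨c, Code.powerConstraint_of_forall_le c ν hpow,
    fun i => c.errorProb_le_of_forall_le ν N i fun m => measure_mono ?_⟩
  rintro ⟨H, Z⟩ hω
  replace hω : g i (H, blockOutput S hT cw K m H Z i) ≠ m i := hω
  by_contra hbad
  replace hbad : (badBlocks S K i H Z).card ≤ D := not_lt.1 hbad
  have hsel := hgB i (H, blockOutput S hT cw K m H Z i) (m i)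
    (mem_explainedBy_self S hT cw hK m hbad)
  have hdist := hammingDist_le_of_mem_explainedBy S hT cw hK m hbad hsel
  exact absurd (hcw i _ _ hω) (not_lt.2 hdist)

end

/-! ### Achievable rates at a given power -/

theorem half_le_floor {x : ℝ} (hx : 1 ≤ x) : x / 2 ≤ (⌊x⌋₊ : ℝ) := by
  have h1 : (1 : ℝ) ≤ ⌊x⌋₊ := by exact_mod_cast (Nat.one_le_floor_iff x).2 hx
  have h2 := Nat.lt_floor_add_one x
  linarith

theorem log_floor_le {x : ℝ} (hx : 1 ≤ x) : Real.log ⌊x⌋₊ ≤ Real.log x := by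
  have h1 : 0 < (⌊x⌋₊ : ℝ) := by exact_mod_cast (Nat.one_le_floor_iff x).2 hx
  exact Real.log_le_log h1 (Nat.floor_le (by linarith))

theorem log_sub_le_log_floor {x : ℝ} (hx : 1 ≤ x) :
    Real.log x - Real.log 2 ≤ Real.log ⌊x⌋₊ := by
  rw [← Real.log_div (by positivity) two_ne_zero]
  exact Real.log_le_log (by positivity) (half_le_floor hx)

theorem tendsto_log_floor_exp_div {R : ℝ} (hR : 0 ≤ R) :
    Tendsto (fun n : ℕ => Real.log (⌊Real.exp (n * R)⌋₊ : ℕ) / n) atTop (𝓝 R) := by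
  have h1 : ∀ n : ℕ, 1 ≤ Real.exp (n * R) := fun n => Real.one_le_exp (by positivity)
  have hlim : Tendsto (fun n : ℕ => R - Real.log 2 / n) atTop (𝓝 R) := by
    simpa using (tendsto_const_nhds (x := R)).sub (tendsto_const_div_atTop_nhds_zero_nat (Real.log 2))
  refine tendsto_of_tendsto_of_tendsto_of_le_of_le' hlim tendsto_const_nhds ?_ ?_
  · filter_upwards [eventually_gt_atTop 0] with n hn
    have hn' : (0 : ℝ) < n := by exact_mod_cast hn
    have := log_sub_le_log_floor (h1 n)
    rw [Real.log_exp] at this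
    rw [le_div_iff₀ hn', sub_mul, div_mul_cancel₀ _ hn'.ne']
    linarith
  · filter_upwards [eventually_gt_atTop 0] with n hn
    have hn' : (0 : ℝ) < n := by exact_mod_cast hn
    have := log_floor_le (h1 n)
    rw [Real.log_exp] at this
    rw [div_le_iff₀ hn']
    linarith

theorem exists_codewords {A : Type*} [Fintype A] [DecidableEq A] [Nonempty A] (m D M : ℕ)
    (h : ∀ k : ℕ, Fintype.card A ^ m ≤ k * (2 ^ m * Fintype.card A ^ D) → M ≤ k) :
    ∃ cw : Fin M → Fin m → A, ∀ x y, x ≠ y → D < hammingDist (cw x) (cw y) := by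
  obtain ⟨C, hC, hcard⟩ := exists_code_hammingDist (ι := Fin m) (A := A) D
  rw [Fintype.card_fin] at hcard
  have hM := h _ hcard
  refine ⟨fun x => (C.equivFin.symm (Fin.castLE hM x) : Fin m → A), fun x y hxy =>
    hC _ (Subtype.coe_prop _) _ (Subtype.coe_prop _) fun e => hxy ?_⟩
  exact Fin.castLE_injective hM (C.equivFin.symm.injective (Subtype.ext e))

/-- The number of messages allowed by the Gilbert–Varshamov bound. -/
theorem floor_exp_le_of_pow_le {q m k D n T : ℕ} {δ R : ℝ} (hq : 1 ≤ q) (hD : (D : ℝ) ≤ 2 * δ * m)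
    (hn : n ≤ T * m + T) (hR0 : 0 ≤ R)
    (hR : R = 0 ∨ T * R + 2 ≤ (1 - 2 * δ) * Real.log q) (hm : T * R ≤ m)
    (h : q ^ m ≤ k * (2 ^ m * q ^ D)) : ⌊Real.exp (n * R)⌋₊ ≤ k := by
  have hk : 0 < k := by
    rcases Nat.eq_zero_or_pos k with rfl | hk
    · rw [zero_mul] at h
      exact absurd h (not_le.2 (pow_pos hq m))
    · exact hk
  rcases hR with rfl | hR
  · rw [mul_zero, Real.exp_zero, Nat.floor_one]
    exact hk
  have hk' : (0 : ℝ) < k := by exact_mod_cast hk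
  have hq' : (0 : ℝ) < q := by exact_mod_cast hq
  have hlogq : 0 ≤ Real.log q := Real.log_nonneg (by exact_mod_cast hq)
  have hlog : m * Real.log q ≤ Real.log k + (m * Real.log 2 + D * Real.log q) := by
    have h' : (q : ℝ) ^ m ≤ k * (2 ^ m * q ^ D) := by exact_mod_cast h
    have := Real.log_le_log (by positivity) h'
    rwa [Real.log_mul (by positivity) (by positivity), Real.log_mul (by positivity) (by positivity),
      Real.log_pow, Real.log_pow, Real.log_pow] at this
  have h2 : Real.log 2 < 1 := by linarith [Real.log_two_lt_d9]
  have hD' : D * Real.log q ≤ 2 * δ * m * Real.log q := mul_le_mul_of_nonneg_right hD hlogq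
  have hn' : (n : ℝ) * R ≤ (T * m + T) * R :=
    mul_le_mul_of_nonneg_right (by exact_mod_cast hn) hR0
  have hm0 : (0 : ℝ) ≤ m := Nat.cast_nonneg m
  have hmR := mul_le_mul_of_nonneg_left hR hm0
  have hml : m * Real.log 2 ≤ m := by nlinarith
  -- The slack 2 per block pays for the factor `2 ^ m` (as `log 2 < 1`) and for the incomplete last
  -- block (as `T * R ≤ m`).
  have hfin : n * R ≤ Real.log k := by nlinarith
  have : (⌊Real.exp (n * R)⌋₊ : ℝ) ≤ k :=
    (Nat.floor_le (Real.exp_pos _).le).trans ((Real.le_log_iff_exp_le hk').1 hfin)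
  exact_mod_cast this

section
variable {csit : ℕ → Fin 3 → CSIT} {T : ℕ} {b : Fin 3 → ℕ}
  (S : LinearScheme csit T b) (ν : Fin 3 → Measure (Fin 3 → ℂ)) [∀ i, IsProbabilityMeasure (ν i)]
  (N : Fin 3 → ℝ≥0)

theorem measure_badBlocks_le (n : ℕ) (K δ : ℝ) (i : Fin 3) :
    ((channelLaw ν n).prod (noiseLaw N n))
        {ω | ⌊δ * (n / T : ℕ)⌋₊ < (badBlocks S K i ω.1 ω.2).card} ≤
      ENNReal.ofReal (Real.exp ((n / T : ℕ) *
        (2 * ((channelLaw ν T).prod (noiseLaw N T)).real (S.badSet i K) - δ))) := by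
  classical
  have hmp := measurePreserving_block_prod (Measure.pi fun i => ν i)
    (Measure.pi fun i => complexGaussian (N i)) n T
  refine le_trans ?_ (measure_pi_count_le ((channelLaw ν T).prod (noiseLaw N T))
    (S.measurableSet_badSet i K) (n / T) δ)
  -- The inequality `Measure.le_map_apply` needs no measurability of the counting event.
  refine le_trans (measure_mono fun ω hω => ?_)
    ((Measure.le_map_apply hmp.aemeasurable _).trans_eq (by rw [hmp.map_eq]; rfl))
  have h := Nat.lt_of_floor_lt (show ⌊δ * (n / T : ℕ)⌋₊ < (badBlocks S K i ω.1 ω.2).card from hω)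
  refine h.trans_le (le_of_eq ?_)
  congr 2

/-- Bad blocks are independent, with probability below `δ / 2`, so more than `δ * (n / T)` of them
is exponentially unlikely; correcting that many costs a fraction `2 * δ` of the rate. -/
theorem mem_capacityRegion (hT : 0 < T) (hper : ∀ t, csit (t + T) = csit t)
    {C : ℝ} (hC : 0 < C)
    (hbound : ∀ (s : (k : Fin 3) → Fin (b k) → ℂ) (A : ℝ), (∀ k l, ‖s k l‖ ≤ A) → 0 ≤ A →
      ∀ H t a, ‖S.signal s H t a‖ ≤ C * A)
    {K : ℝ} (hK : 0 ≤ K) {L : ℕ} (hL : 1 ≤ L) {P : ℝ} (hP : 3 * (C * (2 * K * L)) ^ 2 ≤ P)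
    {δ : ℝ} (hδ : ∀ i, 2 * ((channelLaw ν T).prod (noiseLaw N T)).real (S.badSet i K) < δ)
    {R : Fin 3 → ℝ} (hR0 : ∀ i, 0 ≤ R i)
    (hR : ∀ i, R i = 0 ∨ T * R i + 2 ≤ (1 - 2 * δ) * (2 * b i * Real.log L)) :
    R ∈ capacityRegion ν N csit P := by
  have : NeZero L := ⟨by omega⟩
  have hδ0 : 0 ≤ δ := (mul_nonneg zero_le_two measureReal_nonneg).trans (hδ 0).le
  set M : ℕ → Fin 3 → ℕ := fun n i => ⌊Real.exp (n * R i)⌋₊ with hMdef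
  have hM : ∀ n i, 0 < M n i := fun n i =>
    Nat.floor_pos.2 (Real.one_le_exp (mul_nonneg (Nat.cast_nonneg n) (hR0 i)))
  have hdiv : Tendsto (fun n : ℕ => n / T) atTop atTop := Nat.tendsto_div_const_atTop hT.ne'
  have hlogcard : ∀ i, Real.log (Fintype.card (Letter (b i) L) : ℕ) = 2 * b i * Real.log L := by
    intro i
    simp [Letter]
    rw [Real.log_mul (by positivity) (by positivity)]
    ring
  have hex : ∀ n, ∃ c : Code csit n (M n), c.PowerConstraint ν P ∧
      ((∀ i, T * R i ≤ (n / T : ℕ)) → ∀ i, c.errorProb ν N i ≤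
        ENNReal.ofReal (Real.exp ((n / T : ℕ) *
          (2 * ((channelLaw ν T).prod (noiseLaw N T)).real (S.badSet i K) - δ)))) := by
    intro n
    -- Finitely many short lengths may have too few codewords; the silent code with the same message
    -- sets serves there.
    by_cases hn : ∀ i, T * R i ≤ (n / T : ℕ)
    · have hcw : ∀ i, ∃ cw : Fin (M n i) → Fin (n / T) → Letter (b i) L,
          ∀ x y, x ≠ y → 2 * ⌊δ * (n / T : ℕ)⌋₊ < hammingDist (cw x) (cw y) := fun i => by
        refine exists_codewords _ _ _ fun k hk => ?_
        refine floor_exp_le_of_pow_le (T := T) (δ := δ) Fintype.card_pos ?_ ?_ (hR0 i) ?_ (hn i) hk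
        · have := Nat.floor_le (mul_nonneg hδ0 (Nat.cast_nonneg (n / T)))
          push_cast
          linarith
        · have h1 := Nat.div_add_mod n T
          have h2 := Nat.mod_lt n hT
          omega
        · rw [hlogcard]
          exact hR i
      choose cw hcw using hcw
      obtain ⟨c, hc, hce⟩ := exists_code_of_codewords S cw hT hper ν N hC hbound hK hP (hM n) _ hcw
      exact ⟨c, hc, fun _ i => (hce i).trans (measure_badBlocks_le S ν N n K δ i)⟩
    · obtain ⟨c, hc⟩ := exists_silent_code csit n (hM n) ν P
      exact ⟨c, hc, fun h => absurd h hn⟩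
  choose c hc hce using hex
  refine ⟨M, c, hc, fun i => tendsto_log_floor_exp_div (hR0 i), fun i => ?_⟩
  have hlim : Tendsto (fun n : ℕ => ENNReal.ofReal (Real.exp ((n / T : ℕ) *
      (2 * ((channelLaw ν T).prod (noiseLaw N T)).real (S.badSet i K) - δ)))) atTop (𝓝 0) := by
    rw [← ENNReal.ofReal_zero]
    refine (ENNReal.continuous_ofReal.tendsto 0).comp (Real.tendsto_exp_atBot.comp ?_)
    exact (tendsto_natCast_atTop_atTop.comp hdiv).atTop_mul_const_of_neg (sub_neg.2 (hδ i))
  refine tendsto_of_tendsto_of_tendsto_of_le_of_le' tendsto_const_nhds hlim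
    (Eventually.of_forall fun n => zero_le) ?_
  have hev : ∀ᶠ n : ℕ in atTop, ∀ i, T * R i ≤ ((n / T : ℕ) : ℝ) := by
    rw [eventually_all]
    exact fun i => (tendsto_natCast_atTop_atTop.comp hdiv).eventually_ge_atTop _
  filter_upwards [hev] with n hn using hce n hn i

theorem zero_mem_capacityRegion (csit : ℕ → Fin 3 → CSIT) (P : ℝ) :
    (0 : Fin 3 → ℝ) ∈ capacityRegion ν N csit P := by
  choose c hc using fun n => exists_silent_code csit n (M := fun _ => 1) (fun _ => one_pos) ν P
  refine ⟨fun _ _ => 1, c, hc, fun i => by simp, fun i => ?_⟩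
  have : ∀ n, (c n).errorProb ν N i = 0 := fun n =>
    le_antisymm ((c n).errorProb_le_of_forall_le ν N i fun m => by
      simp [Subsingleton.elim ((c n).dec i _ _) (m i)]) (zero_le)
  simp [this]

/-! ### Degrees of freedom -/

theorem tendsto_levels {C : ℝ} (hC : 0 < C) :
    Tendsto (fun u : ℝ => Real.exp (u / 2) / (C * u)) atTop atTop := by
  have h := (Real.tendsto_exp_div_pow_atTop 1).comp (tendsto_id.atTop_div_const two_pos)
  refine (h.atTop_div_const (show (0 : ℝ) < 2 * C by positivity)).congr fun u => ?_
  simp only [Function.comp, id, pow_one]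
  rw [div_div]
  congr 1
  ring

theorem tendsto_log_levels_div {C : ℝ} (hC : 0 < C) :
    Tendsto (fun u : ℝ => Real.log (⌊Real.exp (u / 2) / (C * u)⌋₊ : ℕ) / u) atTop (𝓝 (1 / 2)) := by
  have hlog : Tendsto (fun u : ℝ => Real.log u / u) atTop (𝓝 0) :=
    Real.isLittleO_log_id_atTop.tendsto_div_nhds_zero
  have hinv : ∀ c : ℝ, Tendsto (fun u : ℝ => c / u) atTop (𝓝 0) := fun c =>
    tendsto_const_nhds.div_atTop tendsto_id
  have hup : Tendsto (fun u : ℝ => 1 / 2 - Real.log C / u - Real.log u / u) atTop (𝓝 (1 / 2)) := by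
    simpa using ((tendsto_const_nhds (x := (1 / 2 : ℝ))).sub (hinv (Real.log C))).sub hlog
  have hlow : Tendsto (fun u : ℝ => 1 / 2 - Real.log C / u - Real.log u / u - Real.log 2 / u)
      atTop (𝓝 (1 / 2)) := by
    simpa using hup.sub (hinv (Real.log 2))
  have hx : ∀ u : ℝ, 0 < u → Real.log (Real.exp (u / 2) / (C * u)) =
      (1 / 2 - Real.log C / u - Real.log u / u) * u := fun u hu => by
    rw [Real.log_div (Real.exp_ne_zero _) (by positivity), Real.log_exp,
      Real.log_mul hC.ne' hu.ne']
    field_simp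
    ring
  refine tendsto_of_tendsto_of_tendsto_of_le_of_le' hlow hup ?_ ?_
  · filter_upwards [(tendsto_levels hC).eventually_ge_atTop 1, eventually_gt_atTop 0] with u h1 hu
    have := log_sub_le_log_floor h1
    rw [hx u hu] at this
    rw [le_div_iff₀ hu, sub_mul, div_mul_cancel₀ (Real.log 2) hu.ne']
    exact this
  · filter_upwards [(tendsto_levels hC).eventually_ge_atTop 1, eventually_gt_atTop 0] with u h1 hu
    have := log_floor_le h1
    rw [hx u hu] at this
    rwa [div_le_iff₀ hu]

/-- With `u = log P` as grid spacing, the bad probability and hence `δ` tend to 0, while `log L` is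
still `u / 2 + o(u)`. The rate per block for receiver `i` is then `b i * u + o(u)`. -/
theorem mem_dofRegion_of_decodable (hT : 0 < T) (hper : ∀ t, csit (t + T) = csit t)
    (hS : S.Decodable ν) : (fun i => (b i / T : ℝ)) ∈ dofRegion ν N csit := by
  obtain ⟨C, hC, hbound⟩ := S.exists_norm_signal_le
  refine ⟨fun i => by positivity, ?_⟩
  set p : Fin 3 → ℝ → ℝ := fun i u =>
    ((channelLaw ν T).prod (noiseLaw N T)).real (S.badSet i u) with hp
  have hp0 : ∀ i u, 0 ≤ p i u := fun i u => measureReal_nonneg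
  -- The term `1 / u` makes the inequality required of `δ` strict.
  set δ : ℝ → ℝ := fun u => 2 * ∑ i, p i u + 1 / u with hδ
  -- The constant 4 keeps the power within `P`: the bound `3 * (C * (2 * u * L)) ^ 2` is at most `3
  -- / 4 * P`.
  set L : ℝ → ℕ := fun u => ⌊Real.exp (u / 2) / (4 * C * u)⌋₊ with hL
  set r : ℝ → Fin 3 → ℝ := fun u i =>
    max 0 (((1 - 2 * δ u) * (2 * b i * Real.log (L u)) - 2) / T) with hr
  have hT' : (0 : ℝ) < T := by exact_mod_cast hT
  have hδlim : Tendsto δ atTop (𝓝 0) := by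
    have h1 : Tendsto (fun u => ∑ i, p i u) atTop (𝓝 0) := by
      simpa using tendsto_finsetSum Finset.univ fun i _ => S.tendsto_measure_badSet hS N i
    simpa [hδ] using (h1.const_mul 2).add tendsto_inv_atTop_zero
  have hrlim : ∀ i, Tendsto (fun u => r u i / u) atTop (𝓝 (b i / T)) := by
    intro i
    have h1 := tendsto_log_levels_div (show 0 < 4 * C by positivity)
    have h2 : Tendsto (fun u => (1 - 2 * δ u) * (2 * b i * (Real.log (L u) / u)) - 2 / u) atTop
        (𝓝 ((1 - 2 * 0) * (2 * b i * (1 / 2)) - 0)) :=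
      ((tendsto_const_nhds.sub (hδlim.const_mul 2)).mul (h1.const_mul _)).sub
        (tendsto_const_nhds.div_atTop tendsto_id)
    have h3 := (tendsto_const_nhds (x := (0 : ℝ))).max (h2.div_const (T : ℝ))
    have e : max (0 : ℝ) (((1 - 2 * 0) * (2 * (b i : ℝ) * (1 / 2)) - 0) / T) = (b i : ℝ) / T := by
      rw [max_eq_right]
      · ring
      · norm_num; positivity
    rw [e] at h3
    refine h3.congr' ?_
    filter_upwards [eventually_gt_atTop 0] with u hu
    simp only [hr]
    rw [← max_div_div_right hu.le, zero_div]
    congr 1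
    field_simp
  -- For small `P` the grid may be empty or its spacing nonpositive; the zero rate is used there,
  -- which does not affect the limit.
  refine ⟨fun P => if 1 < P ∧ 1 ≤ L (Real.log P) then r (Real.log P) else 0, fun P hP => ?_,
    fun i => ?_⟩
  · beta_reduce
    split_ifs with h
    · obtain ⟨h1, h2⟩ := h
      have hu : 0 < Real.log P := Real.log_pos h1
      refine mem_capacityRegion S ν N hT hper hC hbound hu.le h2 ?_ (δ := δ (Real.log P))
        (fun i => ?_) (fun i => le_max_left _ _) fun i => ?_
      · have h3 : (L (Real.log P) : ℝ) ≤ Real.exp (Real.log P / 2) / (4 * C * Real.log P) :=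
          Nat.floor_le (by positivity)
        rw [le_div_iff₀ (by positivity)] at h3
        have h4 : Real.exp (Real.log P / 2) ^ 2 = P := by
          rw [← Real.exp_nat_mul]
          push_cast
          rw [mul_div_cancel₀ _ two_ne_zero, Real.exp_log hP]
        have h5 := pow_le_pow_left₀ (by positivity) h3 2
        rw [h4] at h5
        have h6 : 0 ≤ (L (Real.log P) * (C * Real.log P)) ^ 2 := by positivity
        nlinarith
      · have h3 := Finset.single_le_sum (f := fun i => p i (Real.log P))
          (fun i _ => hp0 i _) (Finset.mem_univ i)
        have h4 : 0 < 1 / Real.log P := by positivity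
        simp only [hδ]
        change 2 * p i (Real.log P) < _
        linarith
      · rcases le_total (((1 - 2 * δ (Real.log P)) * (2 * b i * Real.log (L (Real.log P))) - 2) / T)
          0 with h3 | h3
        · exact Or.inl (max_eq_left h3)
        · right
          simp only [hr]
          rw [max_eq_right h3, mul_div_cancel₀ _ hT'.ne']
          linarith
    · exact zero_mem_capacityRegion ν N csit P
  · refine ((hrlim i).comp Real.tendsto_log_atTop).congr' ?_
    have h1 : ∀ᶠ P in atTop, 1 ≤ L (Real.log P) :=
      (tendsto_nat_floor_atTop.comp ((tendsto_levels (show 0 < 4 * C by positivity)).comp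
        Real.tendsto_log_atTop)).eventually_ge_atTop 1
    filter_upwards [eventually_gt_atTop 1, h1] with P hP1 hP2
    simp only [Function.comp]
    rw [if_pos ⟨hP1, hP2⟩]

end

end MISOBC

end

theorem mainTheorem5 (ν : Fin 3 → MeasureTheory.Measure (Fin 3 → ℂ))
    (hprob : ∀ i, MeasureTheory.IsProbabilityMeasure (ν i))
    (hgen : ∀ i, MISOBC.IsGeneric (ν i))
    (N : Fin 3 → NNReal) (hN : ∀ i, 0 < N i) :
    (∃ S : MISOBC.LinearScheme MISOBC.alternatingCSIT 9 ![9, 4, 4], S.Decodable ν) ∧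
    (![1, 4 / 9, 4 / 9] : Fin 3 → ℝ) ∈ MISOBC.dofRegion ν N MISOBC.alternatingCSIT ∧
    (![1, 4 / 9, 4 / 9] : Fin 3 → ℝ) ∈ Set.extremePoints ℝ MISOBC.hybridOuterBound := by
  have := hprob
  refine ⟨MISOBC.exists_decodable_alternatingCSIT hgen, ?_, MISOBC.corner_mem_extremePoints⟩
  obtain ⟨S, hS⟩ := MISOBC.exists_decodable_alternatingCSIT hgen
  have h := MISOBC.mem_dofRegion_of_decodable S ν N (by norm_num)
    (fun t => by simp [MISOBC.alternatingCSIT]) hS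
  convert h using 1
  ext i
  fin_cases i <;> norm_num
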